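/- Let $F_0$ be a field of characteristic $0$ with an automorphism $\sigma$ and constant field $C=\{c\in F_0\mid\sigma(c)=c\}$, and let $F_n=F_0(t_1,\dots,t_n)$ be a tower of $\Sigma^*$-extensions of $(F_0,\sigma)$: with $F_i=F_0(t_1,\dots,t_i)$, each $t_i$ is transcendental over $F_{i-1}$, $\sigma$ is extended to an automorphism of $F_n$ with $\Delta(t_i)\in F_{i-1}$, where $\Delta(f)=\sigma(f)-f$, and every $f\in F_n$ with $\sigma(f)=f$ lies in $C$. Assume moreover that $\Delta(t_i)\in E_{i-1}$ for $1\le i\le n$, where $E_i=F_0[t_1,\dots,t_i]$ (so that the $E_i$ form a tower of polynomial $\Sigma^*$-ring extensions). For a $C$-space $V$ and a subspace $U$, a $C$-linear map $\phi:V\to V$ is a complete reduction for $U$ if $f-\phi(f)\in U$ for all $f\in V$ and $\ker\phi=U$. Let $\phi_0$ be a complete reduction for $\Delta(F_0)$ on $F_0$ and let $\Theta_0$ be a $C$-basis of $F_0$. For each $i$ with $1\le i\le n$ let $S_i$ be a set of representatives of the monic irreducible polynomials in $F_{i-1}[t_i]$ with respect to the equivalence $p\sim q:\Leftrightarrow p=c\,\sigma^{\ell}(q)$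 for some $c\in F_{i-1}\setminus\{0\}$, $\ell\in\mathbb Z$. The $\Theta_0$-canonical basis $\Xi_i$ of $F_i$ consists of the products $\theta_0\theta_1\cdots\theta_i$ with $\theta_0\in\Theta_0$ and, for $1\le j\le i$, $\theta_j$ of the form $t_j^k$ $(k\ge0)$ or $t_j^k/q^m$ ($q\in F_{j-1}[t_j]$ monic irreducible, $0\le k<\deg q$, $m\ge1$). For $\theta\in\Xi_i$ let $\theta^*:F_i\to C$ be the corresponding coordinate functional. The indicator of $f\in F_n$ is the least $i$ with $f\in F_i$. Define $C$-linear maps $\phi_i:F_i\to F_i$ recursively: for $1\le i\le n$ choose $\theta_i\in\Xi_{i-1}$ with $\theta_i^*(\phi_{i-1}(\Delta(t_i)))\ne0$ whose indicator equals that of $\phi_{i-1}(\Delta(t_i))$, and let $\phi_i$ be the projection of $F_i$ onto $U_{S_i}\oplus V_{\theta_i}$ along $\Delta(F_i)$, where $U_{S_i}$ is the space of rational functions $a/b$ with $a,b\in F_{i-1}[t_i]$, $\deg a<\deg b$ and $b$ a product of elements of $S_i$, and $V_{\theta_i}=\bigoplus_{k\ge0}(\operatorname{im}\phi_{i-1}\cap\ker\theta_i^*)\,t_i^k$.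 Then such choices of $\theta_1,\dots,\theta_n$ exist. Moreover, for every such choice, the following holds. (1) $F_i=\Delta(F_i)\oplus(U_{S_i}\oplus V_{\theta_i})$ for $1\le i\le n$, and for $0\le i\le n$ we have $\Delta(F_i)\subseteq F_i$ and $\phi_i$ is a complete reduction for $\Delta(F_i)$ on $F_i$. (2) For $0\le i\le n$, $\Delta(E_i)\subseteq E_i$, $\phi_i$ maps $E_i$ into $E_i$, and $\phi_i|_{E_i}$ is a complete reduction for $\Delta(E_i)$ on $E_i$. (3) Suppose that $(F_0,\sigma)$ is computable (the elements of $F_0$ are coded so that the field operations, equality and $\sigma$ are computable), that $\Theta_0$ is effective (one can compute, for $a\in F_0\setminus\{0\}$, some $\theta\in\Theta_0$ with $\theta^*(a)\ne0$, and, for $\theta\in\Theta_0$ and $a\in F_0$, the coefficient $\theta^*(a)$), and that $F_0$ is $\phi_0$-computable (there is an algorithm that computes for $f\in F_0$ a pair $(g,\phi_0(f))$ with $g\in F_0$ and $f=\Delta(g)+\phi_0(f)$). Then, for $0\le i\le n$, $E_i$ is $\phi_i$-computable: there is an algorithm that computes for $f\in E_i$, given by its coefficients as a polynomial in $t_1,\dots,t_i$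 over $F_0$, a pair $(g,\phi_i(f))\in E_i^2$ with $f=\Delta(g)+\phi_i(f)$. Here it is not assumed that shift equivalence of polynomials in $F_{i-1}[t_i]$ can be decided or solved, nor that the sets $S_i$ are computable. -/

import Mathlib

universe u v w

open Polynomial

noncomputable section

/-! ### Difference fields, the forward shift operator, complete reductions -/

/-- The constant field `{c | σ c = c}` of a difference field `(F, σ)`. -/
def constField {F : Type u} [Field F] (σ : F ≃+* F) : Subfield F :=
  RingHom.eqLocusField (σ : F →+* F) (RingHom.id F)

/-- The operator `Δ f = σ f - f` of a difference field extension `(L, σ)` of `(F, σ₀)`, as a map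
that is linear over the constants of `(F, σ₀)`. -/
def shiftDiff {F : Type u} {L : Type v} [Field F] [Field L] [Algebra F L]
    (σ₀ : F ≃+* F) (σ : L ≃+* L) (h : ∀ a, σ (algebraMap F L a) = algebraMap F L (σ₀ a)) :
    L →ₗ[constField σ₀] L where
  toFun f := σ f - f
  map_add' f g := by rw [map_add]; ring
  map_smul' c f := by
    have hc : σ₀ (c : F) = c := c.2
    have hs : c • f = algebraMap F L (c : F) * f := Algebra.smul_def (c : F) f
    have hs' : c • (σ f - f) = algebraMap F L (c : F) * (σ f - f) :=
      Algebra.smul_def (c : F) (σ f - f)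
    rw [RingHom.id_apply, hs, hs', map_mul, h, hc]
    ring

/-- The operator `Δ` of a single difference field. -/
def groundDiff {F : Type u} [Field F] (σ₀ : F ≃+* F) : F →ₗ[constField σ₀] F :=
  shiftDiff σ₀ σ₀ (fun _ => rfl)

/-- A linear operator `φ` on `V` is a complete reduction for the subspace `U` if `f - φ f ∈ U` for
all `f`, and `ker φ = U`. -/
structure IsCompleteReduction {C : Type u} {V : Type v} [Field C] [AddCommGroup V] [Module C V]
    (U : Submodule C V) (φ : V →ₗ[C] V) : Prop where
  sub_mem : ∀ f, f - φ f ∈ U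
  ker_eq : LinearMap.ker φ = U

/-- The summable space `Δ(V)`, as a subspace of `V` (used for `V` with `Δ(V) ⊆ V`). -/
def summableSpace {C : Type u} {L : Type v} [Field C] [AddCommGroup L] [Module C L]
    (Δ : L →ₗ[C] L) (V : Submodule C L) : Submodule C V :=
  (V.map Δ).submoduleOf V

open Classical in
/-- The coordinate functional `θ^*` of an element `θ` of a basis `B` of `V`: the linear map with
value `1` at `θ` and `0` at all other elements of `B`. -/
def coordFunctional {C : Type u} {V : Type v} [Field C] [AddCommGroup V] [Module C V]
    (B : Set V) (θ : V) : V →ₗ[C] C :=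
  if h : ∃ l : V →ₗ[C] C, l θ = 1 ∧ ∀ ξ ∈ B, ξ ≠ θ → l ξ = 0 then h.choose else 0

/-! ### Towers of `Σ^*`-extensions -/

/-- The field `F_i = F₀(t_1, …, t_i)`; the generator `t_{j+1}` is `t j`. -/
def towerField (F₀ : Type u) {L : Type v} [Field F₀] [Field L] [Algebra F₀ L]
    (t : ℕ → L) (i : ℕ) : IntermediateField F₀ L :=
  IntermediateField.adjoin F₀ (t '' {j | j < i})

/-- The ring `E_i = F₀[t_1, …, t_i]`; the generator `t_{j+1}` is `t j`. -/
def towerRing (F₀ : Type u) {L : Type v} [Field F₀] [Field L] [Algebra F₀ L]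
    (t : ℕ → L) (i : ℕ) : Subalgebra F₀ L :=
  Algebra.adjoin F₀ (t '' {j | j < i})

/-- A tower `L = F₀(t_1)…(t_n)` of `Σ^*`-extensions of the difference field `(F₀, σ₀)`. The monomial
`t_{i+1}` is `t i`; the values `t i` with `n ≤ i` play no role. -/
structure SigmaTower (F₀ : Type u) (L : Type v) [Field F₀] [Field L] [Algebra F₀ L] (n : ℕ) where
  σ₀ : F₀ ≃+* F₀
  σ : L ≃+* L
  t : ℕ → L
  σ_algebraMap : ∀ a, σ (algebraMap F₀ L a) = algebraMap F₀ L (σ₀ a)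
  field_eq_top : towerField F₀ t n = ⊤
  transcendental : ∀ i < n, Transcendental (towerField F₀ t i) (t i)
  diff_mem : ∀ i < n, σ (t i) - t i ∈ towerField F₀ t i
  const_eq : ∀ x : L, σ x = x → ∃ c : F₀, algebraMap F₀ L c = x

namespace SigmaTower

variable {F₀ : Type u} {L : Type v} [Field F₀] [Field L] [Algebra F₀ L] {n : ℕ}

/-- The common constant field `C`, as a subfield of `F₀`. -/
abbrev C (T : SigmaTower F₀ L n) : Subfield F₀ := constField T.σ₀

/-- `Δ` on the top field of the tower. -/
def Δ (T : SigmaTower F₀ L n) : L →ₗ[T.C] L := shiftDiff T.σ₀ T.σ T.σ_algebraMap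

/-- `F_i` as a `C`-vector space. -/
def fieldSpace (T : SigmaTower F₀ L n) (i : ℕ) : Submodule T.C L :=
  (Subalgebra.toSubmodule (towerField F₀ T.t i).toSubalgebra).restrictScalars T.C

/-- `E_i` as a `C`-vector space. -/
def ringSpace (T : SigmaTower F₀ L n) (i : ℕ) : Submodule T.C L :=
  (Subalgebra.toSubmodule (towerRing F₀ T.t i)).restrictScalars T.C

lemma ringSpace_le_fieldSpace (T : SigmaTower F₀ L n) (i : ℕ) :
    T.ringSpace i ≤ T.fieldSpace i :=
  fun _ hx => IntermediateField.algebra_adjoin_le_adjoin F₀ _ hx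

/-- `Δ(t_{i+1})` as an element of `F_i`. -/
def diffGen (T : SigmaTower F₀ L n) (i : ℕ) (hi : i < n) : T.fieldSpace i :=
  ⟨T.Δ (T.t i), T.diff_mem i hi⟩

/-- The tower is one of `Σ^*`-ring extensions: `Δ(t_i) ∈ E_{i-1}`. -/
def IsRingTower (T : SigmaTower F₀ L n) : Prop :=
  ∀ i < n, T.Δ (T.t i) ∈ T.ringSpace i

lemma mem_fieldSpace_zero (T : SigmaTower F₀ L n) (x : L) :
    x ∈ T.fieldSpace 0 ↔ ∃ a : F₀, algebraMap F₀ L a = x := by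
  change x ∈ towerField F₀ T.t 0 ↔ _
  simp [towerField, IntermediateField.mem_bot]

/-- The identification of the ground field `F₀` with the bottom of the tower. -/
def baseEquiv (T : SigmaTower F₀ L n) : F₀ ≃ₗ[T.C] T.fieldSpace 0 :=
  LinearEquiv.ofBijective
    { toFun := fun a => ⟨algebraMap F₀ L a, (T.mem_fieldSpace_zero _).2 ⟨a, rfl⟩⟩
      map_add' := fun a b => Subtype.ext (map_add (algebraMap F₀ L) a b)
      map_smul' := fun c a => Subtype.ext <| by
        change algebraMap F₀ L ((c : F₀) * a) = (c : F₀) • algebraMap F₀ L a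
        rw [map_mul, Algebra.smul_def] }
    ⟨fun _ _ h => (algebraMap F₀ L).injective (congrArg Subtype.val h),
      fun x => by
        obtain ⟨a, ha⟩ := (T.mem_fieldSpace_zero x.1).1 x.2
        exact ⟨a, Subtype.ext ha⟩⟩

/-! ### The canonical basis, indicators -/

/-- The canonical `F_i`-basis of `F_{i+1} = F_i(t)`: all powers `t^k`, and all `t^k / q^j` with `q`
monic irreducible, `k < deg q`, `1 ≤ j`. -/
def canonicalStep (T : SigmaTower F₀ L n) (i : ℕ) : Set L :=
  {x | (∃ k : ℕ, x = T.t i ^ k) ∨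
    ∃ (q : (towerField F₀ T.t i)[X]) (k j : ℕ), q.Monic ∧ Irreducible q ∧ k < q.natDegree ∧ 1 ≤ j ∧
      x = T.t i ^ k / aeval (T.t i) q ^ j}

/-- The `Θ₀`-canonical `C`-basis of `F_i`: all products `θ₀ θ₁ ⋯ θ_i` with `θ₀ ∈ Θ₀` and `θ_j` in
the canonical `F_{j-1}`-basis of `F_j`. -/
def canonicalBasis (T : SigmaTower F₀ L n) (Θ₀ : Set F₀) : ℕ → Set L
  | 0 => algebraMap F₀ L '' Θ₀
  | i + 1 => {x | ∃ ξ ∈ canonicalBasis T Θ₀ i, ∃ η ∈ T.canonicalStep i, x = ξ * η}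

/-- The coordinate functional `θ^* : F_i → C` with respect to the `Θ₀`-canonical basis. -/
def canonicalCoord (T : SigmaTower F₀ L n) (Θ₀ : Set F₀) (i : ℕ) (θ : T.fieldSpace i) :
    T.fieldSpace i →ₗ[T.C] T.C :=
  coordFunctional {ξ | (ξ : L) ∈ T.canonicalBasis Θ₀ i} θ

/-- The indicator of `f`: the least `i` with `f ∈ F_i`. -/
def indicator (T : SigmaTower F₀ L n) (f : L) : ℕ := sInf {i | f ∈ T.fieldSpace i}

/-! ### The complementary space -/

/-- The monic irreducible polynomials in `F_i[t]`, `t = t_{i+1}`, as elements of `F_{i+1}`. -/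
def monicIrreducibles (T : SigmaTower F₀ L n) (i : ℕ) : Set L :=
  {x | ∃ p : (towerField F₀ T.t i)[X], p.Monic ∧ Irreducible p ∧ x = aeval (T.t i) p}

/-- `σ`-equivalence of elements of `F_i[t]`: `p = c σ^l(q)` with `c ∈ F_i` nonzero and `l ∈ ℤ`. -/
def ShiftEquivalent (T : SigmaTower F₀ L n) (i : ℕ) (p q : L) : Prop :=
  ∃ c ∈ T.fieldSpace i, c ≠ 0 ∧ ∃ l : ℤ, p = c * (T.σ ^ l) q

/-- `S` is a set of representatives of the classes of `σ`-equivalence on the monic irreducible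
polynomials in `F_i[t]`. -/
def IsRepresentatives (T : SigmaTower F₀ L n) (i : ℕ) (S : Set L) : Prop :=
  S ⊆ T.monicIrreducibles i ∧
    ∀ q ∈ T.monicIrreducibles i, ∃! p, p ∈ S ∧ T.ShiftEquivalent i p q

/-- The space `U_S` of the proper rational functions in `F_i(t)` whose denominator is a product of
elements of `S`. -/
def properComplement (T : SigmaTower F₀ L n) (i : ℕ) (S : Set L) : Submodule T.C L :=
  Submodule.span T.C
    {x | ∃ a b : (towerField F₀ T.t i)[X], a.degree < b.degree ∧
      aeval (T.t i) b ∈ Submonoid.closure S ∧ x = aeval (T.t i) a / aeval (T.t i) b}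

/-- The `θ`-complement `V_θ = ⨁_k (im φ ∩ ker θ^*) t^k` inside `F_i[t]`, where `φ` is a reduction on
`F_i` and `l = θ^*`. -/
def polyComplement (T : SigmaTower F₀ L n) (i : ℕ) (l : T.fieldSpace i →ₗ[T.C] T.C)
    (φ : T.fieldSpace i →ₗ[T.C] T.fieldSpace i) : Submodule T.C L :=
  Submodule.span T.C
    {x | ∃ a ∈ LinearMap.range φ ⊓ LinearMap.ker l, ∃ k : ℕ, x = (a : L) * T.t i ^ k}

/-- `U_S ⊕ V_θ` as a subspace of `F_{i+1}`. -/
def complement (T : SigmaTower F₀ L n) (i : ℕ) (S : Set L) (l : T.fieldSpace i →ₗ[T.C] T.C)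
    (φ : T.fieldSpace i →ₗ[T.C] T.fieldSpace i) : Submodule T.C (T.fieldSpace (i + 1)) :=
  (T.properComplement i S ⊔ T.polyComplement i l φ).submoduleOf (T.fieldSpace (i + 1))

/-! ### The complete reductions of the tower -/

open Classical in
/-- The map `ψ_{(S, θ)}` on `F_{i+1}` obtained from `φ` on `F_i`: the projection onto `U_S ⊕ V_θ`
along `Δ(F_{i+1})`. -/
def reductionStep (T : SigmaTower F₀ L n) (i : ℕ) (S : Set L) (l : T.fieldSpace i →ₗ[T.C] T.C)
    (φ : T.fieldSpace i →ₗ[T.C] T.fieldSpace i) :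
    T.fieldSpace (i + 1) →ₗ[T.C] T.fieldSpace (i + 1) :=
  if h : IsCompl (T.complement i S l φ) (summableSpace T.Δ (T.fieldSpace (i + 1))) then
    (T.complement i S l φ).projection (summableSpace T.Δ (T.fieldSpace (i + 1))) h
  else 0

/-- The maps `φ_i` on `F_i` defined recursively from `φ₀`, the sets `S_{i+1} = S i` of
representatives and the elements `θ_{i+1} = θ i`. -/
def reduction (T : SigmaTower F₀ L n) (Θ₀ : Set F₀) (φ₀ : F₀ →ₗ[T.C] F₀) (S : ℕ → Set L)
    (θ : (i : ℕ) → T.fieldSpace i) : (i : ℕ) → (T.fieldSpace i →ₗ[T.C] T.fieldSpace i)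
  | 0 => T.baseEquiv.conj φ₀
  | i + 1 => T.reductionStep i (S i) (T.canonicalCoord Θ₀ i (θ i)) (reduction T Θ₀ φ₀ S θ i)

/-- The `θ_{i+1} = θ i` are the first components of second pairs: `θ_{i+1}` is an element of the
canonical basis that is effective for `φ_i(Δ(t_{i+1}))` and has the same indicator. -/
def IsSecondPairs (T : SigmaTower F₀ L n) (Θ₀ : Set F₀) (φ₀ : F₀ →ₗ[T.C] F₀) (S : ℕ → Set L)
    (θ : (i : ℕ) → T.fieldSpace i) : Prop :=
  ∀ (i : ℕ) (hi : i < n),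
    (θ i : L) ∈ T.canonicalBasis Θ₀ i ∧
    T.canonicalCoord Θ₀ i (θ i) (T.reduction Θ₀ φ₀ S θ i (T.diffGen i hi)) ≠ 0 ∧
    T.indicator (θ i) = T.indicator (T.reduction Θ₀ φ₀ S θ i (T.diffGen i hi))

end SigmaTower

/-! ### Computability -/

/-- The difference field `(F, σ)` is computable for the given coding of its elements. (A
`Primcodable` coding is injective, so equality is decidable.) -/
structure IsComputableDifferenceField (F : Type u) [Field F] [Primcodable F] (σ : F ≃+* F) :
    Prop where
  add : Computable₂ (fun a b : F => a + b)
  neg : Computable (fun a : F => -a)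
  mul : Computable₂ (fun a b : F => a * b)
  inv : Computable (fun a : F => a⁻¹)
  shift : Computable (fun a : F => σ a)

/-- A basis of a field over a subfield is effective if one can compute, for `a ≠ 0`, a basis element
with nonzero coefficient in `a`, and the coefficient of a given basis element in a given `a`. -/
def IsEffectiveBasis {F : Type u} [Field F] [Primcodable F] {C : Subfield F} {ι : Type w}
    (b : Module.Basis ι C F) : Prop :=
  (∃ find : F → F, Computable find ∧ ∀ a, a ≠ 0 → ∃ k, find a = b k ∧ b.repr a k ≠ 0) ∧
  ∃ coeff : F → F → F, Computable₂ coeff ∧ ∀ k a, coeff (b k) a = (b.repr a k : F)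

/-- `V`, with elements coded by `ν : α → V`, is `φ`-computable: some algorithm computes from a code
of `f` codes of `g` and `φ f` with `f = Δ g + φ f`. -/
def IsPhiComputable {α : Type u} {C : Type v} {V : Type w} [Primcodable α] [Field C]
    [AddCommGroup V] [Module C V] (ν : α → V) (Δ φ : V →ₗ[C] V) : Prop :=
  Function.Surjective ν ∧
  ∃ A : α → α × α, Computable A ∧
    ∀ a, ν (A a).2 = φ (ν a) ∧ ν a = Δ (ν (A a).1) + ν (A a).2

/-- Codes for recursive polynomials in `i` variables with coefficients in `A`: a polynomial in
`i + 1` variables is the list of its coefficients, which are polynomials in `i` variables. -/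
def PolyCode (A : Type u) : ℕ → Type u
  | 0 => A
  | i + 1 => List (PolyCode A i)

instance PolyCode.instPrimcodable (A : Type u) [Primcodable A] :
    (i : ℕ) → Primcodable (PolyCode A i)
  | 0 => inferInstanceAs (Primcodable A)
  | i + 1 =>
    letI := PolyCode.instPrimcodable A i
    inferInstanceAs (Primcodable (List (PolyCode A i)))

namespace SigmaTower

variable {F₀ : Type u} {L : Type v} [Field F₀] [Field L] [Algebra F₀ L] {n : ℕ}

/-- The element coded by a recursive polynomial; `[c₀, …, c_d]` codes `∑ c_k t_{i+1}^k`. -/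
def evalCode (T : SigmaTower F₀ L n) : (i : ℕ) → PolyCode F₀ i → L
  | 0 => fun a => algebraMap F₀ L a
  | i + 1 => fun l : List (PolyCode F₀ i) =>
      l.foldr (fun c x => evalCode T i c + T.t i * x) 0

lemma evalCode_mem (T : SigmaTower F₀ L n) (i : ℕ) (c : PolyCode F₀ i) :
    T.evalCode i c ∈ T.ringSpace i := by
  change T.evalCode i c ∈ towerRing F₀ T.t i
  induction i with
  | zero => exact (towerRing F₀ T.t 0).algebraMap_mem c
  | succ i ih =>
    have hle : towerRing F₀ T.t i ≤ towerRing F₀ T.t (i + 1) :=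
      Algebra.adjoin_mono (Set.image_mono fun j (hj : j < i) => Nat.lt_succ_of_lt hj)
    have ht : T.t i ∈ towerRing F₀ T.t (i + 1) :=
      Algebra.subset_adjoin ⟨i, Nat.lt_succ_self i, rfl⟩
    change List (PolyCode F₀ i) at c
    change c.foldr (fun c x => T.evalCode i c + T.t i * x) 0 ∈ _
    induction c with
    | nil => exact zero_mem _
    | cons a l ihl => exact add_mem (hle (ih a)) (mul_mem ht ihl)

/-- The coding of the elements of `E_i` by recursive polynomials over `F₀`. -/
def ringCoding (T : SigmaTower F₀ L n) (i : ℕ) (c : PolyCode F₀ i) : T.ringSpace i :=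
  ⟨T.evalCode i c, T.evalCode_mem i c⟩

end SigmaTower

end

/-!
Let `t = t_{i+1}`. By partial fractions and by moving each denominator along its `σ`-orbit, every
element of `F_i(t)` is, modulo `Δ`, the sum of an element of `U_S` and a polynomial in `t`. Modulo
`Δ(c t^k)` with `c ∈ F_i`, a coefficient of `t^k` may be replaced by its remainder under `φ_i`;
since `Δ(t^{k+1})` has leading term `(k + 1) Δ(t) t^k` and `θ^*(φ_i(Δ(t))) ≠ 0`, the remainder can
be moved further into `ker θ^*`. Hence `F_{i+1} = Δ(F_{i+1}) + U_S + V_θ`. The sum is direct: a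
pole of `f` gives two distinct `σ`-equivalent poles of `Δ(f)`, which an element of `U_S` cannot
have, so only polynomials `f` remain, and these are handled by comparing leading coefficients.
A suitable `θ` exists because the constants do not grow, so that `Δ(t) ∉ Δ(F_i)`.

All coefficient operations of the polynomial part stay in `E_i`, which gives the statement on
`E_{i+1}`. As the sum is direct, any `f = Δ(g) + r` with `r ∈ E_i[t]` and coefficients in
`im φ_i ∩ ker θ^*` has `r = φ_{i+1}(f)`; such a pair is known to exist and is recognizable, so an
unbounded search finds it without any knowledge of `S`.
-/

noncomputable section

/-! ### Difference polynomials in one variable -/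

/-- The automorphism of `R[X]` that acts as `τ` on the coefficients and maps `X` to `X + a`: the
shift operator of a `Σ^*`-extension, restricted to polynomials. -/
def shiftPoly {R : Type*} [CommRing R] (τ : R ≃+* R) (a : R) : R[X] ≃+* R[X] :=
  (Polynomial.mapEquiv τ).trans (taylorEquiv a).toRingEquiv

/-- The polynomials all of whose coefficients lie in the additive subgroup `A`. -/
def coeffsIn {R : Type*} [CommRing R] (A : AddSubgroup R) : AddSubgroup R[X] where
  carrier := {p | ∀ k, p.coeff k ∈ A}
  zero_mem' _ := by simp
  add_mem' hp hq k := by simpa using A.add_mem (hp k) (hq k)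
  neg_mem' hp k := by simpa using A.neg_mem (hp k)

section ShiftPoly

variable {R : Type*} [CommRing R] (τ : R ≃+* R) (a : R)

lemma C_mul_X_pow_mem_coeffsIn {A : AddSubgroup R} {c : R} (hc : c ∈ A) (N : ℕ) :
    C c * X ^ N ∈ coeffsIn A := fun k => by
  rw [coeff_C_mul_X_pow]
  split_ifs
  · exact hc
  · exact A.zero_mem

lemma shiftPoly_apply (p : R[X]) : shiftPoly τ a p = taylor a (p.map (τ : R →+* R)) := rfl

@[simp]
lemma shiftPoly_C (c : R) : shiftPoly τ a (C c) = C (τ c) := by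
  simp [shiftPoly_apply]

@[simp]
lemma shiftPoly_X : shiftPoly τ a X = X + C a := by
  simp [shiftPoly_apply]

@[simp]
lemma degree_shiftPoly (p : R[X]) : (shiftPoly τ a p).degree = p.degree := by
  rw [shiftPoly_apply, degree_taylor, degree_map_eq_of_injective τ.injective]

@[simp]
lemma natDegree_shiftPoly (p : R[X]) : (shiftPoly τ a p).natDegree = p.natDegree :=
  natDegree_eq_of_degree_eq (degree_shiftPoly τ a p)

lemma leadingCoeff_shiftPoly (p : R[X]) :
    (shiftPoly τ a p).leadingCoeff = τ p.leadingCoeff := by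
  rw [shiftPoly_apply, leadingCoeff_taylor, leadingCoeff_map_of_injective τ.injective]
  rfl

lemma monic_shiftPoly_iff {p : R[X]} : (shiftPoly τ a p).Monic ↔ p.Monic := by
  rw [Monic, Monic, leadingCoeff_shiftPoly, EmbeddingLike.map_eq_one_iff]

lemma coeff_shiftPoly {p : R[X]} {k N : ℕ} (hp : p.natDegree < N + k) :
    (shiftPoly τ a p).coeff k =
      ∑ j ∈ Finset.range N, ((j + k).choose k : R) * τ (p.coeff (j + k)) * a ^ j := by
  have hdeg : (hasseDeriv k (p.map (τ : R →+* R))).natDegree < N ∨ N = 0 := by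
    have := natDegree_hasseDeriv_le (p.map (τ : R →+* R)) k
    have := natDegree_map_le (p := p) (f := (τ : R →+* R))
    omega
  rcases hdeg with hdeg | rfl
  · rw [shiftPoly_apply, taylor_coeff, eval_eq_sum_range' hdeg]
    simp [hasseDeriv_coeff]
  · rw [Finset.range_zero, Finset.sum_empty]
    exact coeff_eq_zero_of_natDegree_lt (by simpa using hp)

lemma coeff_shiftPoly_of_natDegree_le {p : R[X]} {N : ℕ} (hp : p.natDegree ≤ N) :
    (shiftPoly τ a p).coeff N = τ (p.coeff N) := by
  simpa using coeff_shiftPoly τ a (N := 1) (k := N) (by omega : p.natDegree < 1 + N)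

lemma coeff_shiftPoly_of_natDegree_le_succ {p : R[X]} {N : ℕ} (hp : p.natDegree ≤ N + 1) :
    (shiftPoly τ a p).coeff N = τ (p.coeff N) + (N + 1) * τ (p.coeff (N + 1)) * a := by
  rw [coeff_shiftPoly τ a (N := 2) (k := N) (by omega), Finset.sum_range_succ,
    Finset.sum_range_one, add_comm 1 N]
  simp

lemma shiftPoly_mem_coeffsIn {O : Subring R} (hτ : ∀ x ∈ O, τ x ∈ O) (ha : a ∈ O) {p : R[X]}
    (hp : p ∈ coeffsIn O.toAddSubgroup) : shiftPoly τ a p ∈ coeffsIn O.toAddSubgroup := fun k => by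
  rw [coeff_shiftPoly τ a (by omega : p.natDegree < (p.natDegree + 1) + k)]
  exact O.sum_mem fun j _ =>
    O.mul_mem (O.mul_mem (natCast_mem O _) (hτ _ (hp _))) (O.pow_mem ha _)

/-- For a term `c X ^ N` with `c = τ g - g + (N + 1) m a + w`, the term of degree `N + 1` in the
witness produces the summand `(N + 1) m a`. -/
lemma degree_sub_shiftPoly_sub_lt {p : R[X]} {N : ℕ} (hp : p.degree < (N + 1 : ℕ)) {g m w : R}
    (hm : τ m = m) (hc : p.coeff N = τ g - g + (N + 1) * m * a + w) {G : R[X]}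
    (hG : G = C g * X ^ N + C m * X ^ (N + 1)) :
    (p - (shiftPoly τ a G - G) - C w * X ^ N).degree < (N : WithBot ℕ) := by
  have hdegG : G.natDegree ≤ N + 1 := by
    rw [hG]
    compute_degree
  rw [degree_lt_iff_coeff_zero] at hp ⊢
  intro k hk
  simp only [coeff_sub]
  rcases (by omega : k = N ∨ k = N + 1 ∨ N + 1 < k) with rfl | rfl | hk'
  · rw [coeff_shiftPoly_of_natDegree_le_succ τ a hdegG, hc]
    simp [hG, hm, coeff_X_pow]
    ring
  · rw [coeff_shiftPoly_of_natDegree_le τ a hdegG, hp _ le_rfl]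
    simp [hG, hm, coeff_X_pow]
  · rw [hp k hk'.le, coeff_eq_zero_of_natDegree_lt (p := G) (by omega),
      coeff_eq_zero_of_natDegree_lt (p := shiftPoly τ a G) (by simpa using by omega)]
    simp [coeff_X_pow, show k ≠ N by omega]

variable {K : Type*} [Field K] [CharZero K] {τ : K ≃+* K} {a : K}

theorem exists_eq_shiftPoly_sub_self_add {O : Subring K} {W : AddSubgroup K}
    (hτ : ∀ x ∈ O, τ x ∈ O) (ha : a ∈ O) (hinv : ∀ n : ℕ, (n : K)⁻¹ ∈ O)
    (H : ∀ c ∈ O, ∃ g ∈ O, ∃ m ∈ O, ∃ w ∈ O.toAddSubgroup ⊓ W,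
      τ m = m ∧ c = τ g - g + m * a + w)
    {p : K[X]} (hp : p ∈ coeffsIn O.toAddSubgroup) :
    ∃ g ∈ coeffsIn O.toAddSubgroup, ∃ r ∈ coeffsIn (O.toAddSubgroup ⊓ W),
      p = shiftPoly τ a g - g + r := by
  suffices ∀ (N : ℕ) (p : K[X]), p.degree < N → p ∈ coeffsIn O.toAddSubgroup →
      ∃ g ∈ coeffsIn O.toAddSubgroup, ∃ r ∈ coeffsIn (O.toAddSubgroup ⊓ W),
        p = shiftPoly τ a g - g + r from
    this (p.natDegree + 1) p (degree_lt_iff_coeff_zero _ _ |>.2 fun k hk =>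
      coeff_eq_zero_of_natDegree_lt hk) hp
  intro N
  induction N with
  | zero =>
    intro p hpN _
    have hp0 : p = 0 := by simpa [Nat.WithBot.lt_zero_iff] using hpN
    exact ⟨0, zero_mem _, 0, zero_mem _, by simp [hp0]⟩
  | succ N ih =>
    intro p hpN hpO
    obtain ⟨g, hg, m, hm, w, hw, hτm, hc⟩ := H (p.coeff N) (hpO N)
    set G : K[X] := C g * X ^ N + C (m * ((N + 1 : ℕ) : K)⁻¹) * X ^ (N + 1) with hG
    have hGO : G ∈ coeffsIn O.toAddSubgroup :=
      add_mem (C_mul_X_pow_mem_coeffsIn hg _) (C_mul_X_pow_mem_coeffsIn (O.mul_mem hm (hinv _)) _)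
    have hlt : (p - (shiftPoly τ a G - G) - C w * X ^ N).degree < (N : WithBot ℕ) := by
      refine degree_sub_shiftPoly_sub_lt τ a hpN ?_ ?_ hG
      · rw [map_mul, map_inv₀, map_natCast, hτm]
      · have hN : (N : K) + 1 ≠ 0 := Nat.cast_add_one_ne_zero N
        rw [hc, Nat.cast_succ]
        field_simp
    obtain ⟨g', hg', r', hr', h'⟩ := ih _ hlt <|
      sub_mem (sub_mem hpO (sub_mem (shiftPoly_mem_coeffsIn τ a hτ ha hGO) hGO))
        (C_mul_X_pow_mem_coeffsIn hw.1 N)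
    refine ⟨g' + G, add_mem hg' hGO, r' + C w * X ^ N,
      add_mem hr' (C_mul_X_pow_mem_coeffsIn hw N), ?_⟩
    rw [map_add]
    linear_combination h'

theorem shiftPoly_eq_self_of_sub_self_mem_coeffsIn {W : AddSubgroup K}
    (H : ∀ g m, τ m = m → τ g - g + m * a ∈ W → m = 0 ∧ τ g = g)
    {g : K[X]} (hg : shiftPoly τ a g - g ∈ coeffsIn W) : shiftPoly τ a g = g := by
  have hlead : τ g.leadingCoeff = g.leadingCoeff := by
    have h := hg g.natDegree
    rw [coeff_sub, coeff_shiftPoly_of_natDegree_le τ a le_rfl] at h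
    exact (H _ 0 (map_zero τ) (by simpa using h)).2
  rcases hd : g.natDegree with _ | d
  · rw [eq_C_of_natDegree_eq_zero hd] at hlead ⊢
    rw [shiftPoly_C]
    rw [leadingCoeff_C] at hlead
    rw [hlead]
  · have h := hg d
    rw [coeff_sub, coeff_shiftPoly_of_natDegree_le_succ τ a hd.le, ← hd, coeff_natDegree,
      hlead] at h
    have hzero := (H (g.coeff d) ((d + 1 : ℕ) * g.leadingCoeff)
      (by rw [map_mul, map_natCast, hlead]) (by push_cast; convert h using 1; ring)).1
    have hg0 : g = 0 := by
      simpa [Nat.cast_add_one_ne_zero] using hzero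
    simp [hg0] at hd

end ShiftPoly

/-- `f` is a quotient of polynomials in `t` whose denominator is not divisible by `q`; for
irreducible `q` this says that `f` has no pole at `q`. -/
def RegularAt {K L : Type*} [Field K] [Field L] [Algebra K L] (t : L) (q : K[X]) (f : L) : Prop :=
  ∃ a b : K[X], ¬ q ∣ b ∧ f = aeval t a / aeval t b

section Regular

variable {K L : Type*} [Field K] [Field L] [Algebra K L] {t : L}

lemma aeval_ne_zero_of_transcendental (ht : Transcendental K t) {b : K[X]} (hb : b ≠ 0) :
    aeval t b ≠ 0 := fun h => hb (transcendental_iff.1 ht b h)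

lemma regularAt_aeval {q : K[X]} (hq : Prime q) (p : K[X]) : RegularAt t q (aeval t p) :=
  ⟨p, 1, fun h => hq.not_isUnit (isUnit_of_dvd_one h), by simp⟩

namespace RegularAt

variable {q : K[X]} {f g : L}

lemma neg (hf : RegularAt t q f) : RegularAt t q (-f) := by
  obtain ⟨a, b, hb, rfl⟩ := hf
  exact ⟨-a, b, hb, by rw [map_neg, neg_div]⟩

variable (ht : Transcendental K t) (hq : Prime q)
include ht hq

lemma sub (hf : RegularAt t q f) (hg : RegularAt t q g) : RegularAt t q (f - g) := by
  obtain ⟨a, b, hb, rfl⟩ := hf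
  obtain ⟨c, d, hd, rfl⟩ := hg
  have hb0 : aeval t b ≠ 0 := aeval_ne_zero_of_transcendental ht (by rintro rfl; simp at hb)
  have hd0 : aeval t d ≠ 0 := aeval_ne_zero_of_transcendental ht (by rintro rfl; simp at hd)
  refine ⟨a * d - b * c, b * d, fun h => (hq.dvd_or_dvd h).elim hb hd, ?_⟩
  rw [div_sub_div _ _ hb0 hd0, map_sub, map_mul, map_mul, map_mul]

lemma add (hf : RegularAt t q f) (hg : RegularAt t q g) : RegularAt t q (f + g) := by
  simpa using hf.sub ht hq hg.neg

lemma dvd_of_mul {c d : K[X]} (hd : d ≠ 0)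
    (h : RegularAt t q (aeval t c / aeval t (q * d))) : q ∣ c := by
  obtain ⟨a, b, hb, hab⟩ := h
  have hb0 : aeval t b ≠ 0 := aeval_ne_zero_of_transcendental ht (by rintro rfl; simp at hb)
  have hqd0 := aeval_ne_zero_of_transcendental ht (mul_ne_zero hq.ne_zero hd)
  rw [div_eq_div_iff hqd0 hb0, ← map_mul, ← map_mul] at hab
  have hcb : c * b = a * (q * d) := transcendental_iff_injective.1 ht hab
  exact (hq.dvd_or_dvd ⟨a * d, by rw [hcb]; ring⟩).resolve_right hb

end RegularAt

lemma exists_aeval_eq_of_regularAt (ht : Transcendental K t) {a b : K[X]} (hb : b ≠ 0)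
    (h : ∀ q : K[X], q.Monic → Irreducible q → RegularAt t q (aeval t a / aeval t b)) :
    ∃ p : K[X], aeval t p = aeval t a / aeval t b := by
  induction hn : b.natDegree using Nat.strong_induction_on generalizing a b with
  | _ n ih =>
    by_cases hu : IsUnit b
    · obtain ⟨c, hc⟩ := hu.exists_right_inv
      refine ⟨a * c, ?_⟩
      rw [eq_div_iff (aeval_ne_zero_of_transcendental ht hb), ← map_mul, mul_assoc, mul_comm c,
        hc, mul_one]
    · obtain ⟨q, hqm, hqi, b', rfl⟩ := exists_monic_irreducible_factor b hu
      have hb' : b' ≠ 0 := right_ne_zero_of_mul hb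
      obtain ⟨a', rfl⟩ := (h q hqm hqi).dvd_of_mul ht hqi.prime hb'
      have hcancel : aeval t (q * a') / aeval t (q * b') = aeval t a' / aeval t b' := by
        rw [map_mul, map_mul,
          mul_div_mul_left _ _ (aeval_ne_zero_of_transcendental ht hqi.ne_zero)]
      rw [hcancel] at h ⊢
      refine ih b'.natDegree ?_ hb' h rfl
      have hqpos := hqi.natDegree_pos
      rw [← hn, natDegree_mul hqi.ne_zero hb']
      omega

end Regular

section ShiftPolyZPow

variable {R : Type*} [CommRing R] (τ : R ≃+* R) (a : R)

lemma ringAut_zpow_apply_iff {A : Type*} [Mul A] [Add A] (τ : A ≃+* A) {P : A → Prop}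
    (hP : ∀ x, P (τ x) ↔ P x) (l : ℤ) (x : A) : P ((τ ^ l) x) ↔ P x := by
  induction l using Int.induction_on generalizing x with
  | zero => simp
  | succ n ih => rw [zpow_add_one, RingAut.mul_apply, ih, hP]
  | pred n ih =>
    rw [zpow_sub_one, RingAut.mul_apply, RingAut.inv_apply, ih, ← hP, RingEquiv.apply_symm_apply]

lemma monic_shiftPoly_zpow_iff (l : ℤ) {p : R[X]} : ((shiftPoly τ a ^ l) p).Monic ↔ p.Monic :=
  ringAut_zpow_apply_iff (shiftPoly τ a) (fun _ => monic_shiftPoly_iff τ a) l p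

lemma degree_shiftPoly_zpow (l : ℤ) (p : R[X]) : ((shiftPoly τ a ^ l) p).degree = p.degree :=
  (ringAut_zpow_apply_iff (shiftPoly τ a) (P := fun q => q.degree = p.degree) (by simp) l p).2 rfl

lemma irreducible_shiftPoly_zpow_iff (l : ℤ) {p : R[X]} :
    Irreducible ((shiftPoly τ a ^ l) p) ↔ Irreducible p :=
  MulEquiv.irreducible_iff (shiftPoly τ a ^ l : R[X] ≃+* R[X])

lemma shiftPoly_shiftPoly_zpow (l : ℤ) (p : R[X]) :
    shiftPoly τ a ((shiftPoly τ a ^ l) p) = (shiftPoly τ a ^ (l + 1)) p := by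
  rw [add_comm, zpow_one_add, RingAut.mul_apply]

end ShiftPolyZPow

/-- `t` is a `Σ^*`-monomial over `(K, τ)` with `σ t = t + a`, inside the difference field
`(L, σ)`; all constants of `L` are required to lie in `K`. -/
structure IsSigmaMonomial {K L : Type*} [Field K] [Field L] [Algebra K L] (σ : L ≃+* L)
    (τ : K ≃+* K) (t : L) (a : K) : Prop where
  transcendental : Transcendental K t
  map_algebraMap : ∀ c, σ (algebraMap K L c) = algebraMap K L (τ c)
  map_gen : σ t = t + algebraMap K L a
  exists_algebraMap_eq : ∀ x, σ x = x → ∃ c, algebraMap K L c = x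

namespace IsSigmaMonomial

variable {K L : Type*} [Field K] [Field L] [Algebra K L] {σ : L ≃+* L} {τ : K ≃+* K} {t : L}
  {a : K} (ht : IsSigmaMonomial σ τ t a)
include ht

lemma aeval_injective : Function.Injective (aeval t : K[X] →ₐ[K] L) :=
  transcendental_iff_injective.1 ht.transcendental

lemma aeval_shiftPoly (p : K[X]) : aeval t (shiftPoly τ a p) = σ (aeval t p) := by
  induction p using Polynomial.induction_on' with
  | add p q hp hq => simp only [map_add, hp, hq]
  | monomial n c =>
    rw [← C_mul_X_pow_eq_monomial]
    simp [ht.map_algebraMap, ht.map_gen]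

lemma aeval_shiftPoly_zpow (l : ℤ) (p : K[X]) :
    aeval t ((shiftPoly τ a ^ l) p) = (σ ^ l) (aeval t p) := by
  induction l using Int.induction_on generalizing p with
  | zero => simp
  | succ n ih =>
    rw [zpow_add_one, zpow_add_one, RingAut.mul_apply, RingAut.mul_apply, ih, ht.aeval_shiftPoly]
  | pred n ih =>
    rw [zpow_sub_one, zpow_sub_one, RingAut.mul_apply, RingAut.mul_apply, ih]
    congr 1
    rw [RingAut.inv_apply, RingAut.inv_apply, RingEquiv.eq_symm_apply, ← ht.aeval_shiftPoly,
      RingEquiv.apply_symm_apply]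

lemma exists_eq_C_of_shiftPoly_eq_self {p : K[X]} (hp : shiftPoly τ a p = p) :
    ∃ c, p = C c := by
  obtain ⟨c, hc⟩ := ht.exists_algebraMap_eq (aeval t p) (by rw [← ht.aeval_shiftPoly, hp])
  exact ⟨c, ht.aeval_injective (by rw [← hc, aeval_C])⟩

/-- Otherwise the product over the finite orbit would be a nonconstant invariant polynomial. -/
lemma shiftPoly_pow_ne_self {q : K[X]} (hq : Irreducible q) {n : ℕ} (hn : n ≠ 0) :
    (shiftPoly τ a ^ n) q ≠ q := by
  intro hnq
  set P : K[X] := ∏ i ∈ Finset.range n, (shiftPoly τ a ^ i) q with hP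
  have hPinv : shiftPoly τ a P = P := by
    have hsucc (i : ℕ) : shiftPoly τ a ((shiftPoly τ a ^ i) q) = (shiftPoly τ a ^ (i + 1)) q := by
      rw [pow_succ', RingAut.mul_apply]
    obtain ⟨m, rfl⟩ := Nat.exists_eq_succ_of_ne_zero hn
    rw [hP, map_prod]
    simp only [hsucc]
    rw [Finset.prod_range_succ, hnq, Finset.prod_range_succ', pow_zero, RingAut.one_apply]
  obtain ⟨c, hc⟩ := ht.exists_eq_C_of_shiftPoly_eq_self hPinv
  have hdvd : q ∣ P := by
    have := Finset.dvd_prod_of_mem (fun i => (shiftPoly τ a ^ i) q)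
      (Finset.mem_range.2 (Nat.pos_of_ne_zero hn))
    rwa [pow_zero, RingAut.one_apply] at this
  have hP0 : P ≠ 0 := Finset.prod_ne_zero_iff.2 fun i _ =>
    (map_ne_zero_iff _ (RingEquiv.injective (shiftPoly τ a ^ i))).2 hq.ne_zero
  have hdeg := natDegree_le_of_dvd hdvd hP0
  rw [hc, natDegree_C] at hdeg
  exact absurd hq.natDegree_pos (by omega)

lemma shiftPoly_zpow_injective {q : K[X]} (hq : Irreducible q) :
    Function.Injective fun l : ℤ => (shiftPoly τ a ^ l) q := by
  intro l m hlm
  wlog hle : m ≤ l generalizing l m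
  · exact (this hlm.symm (by omega)).symm
  obtain ⟨n, rfl⟩ := Int.le.dest hle
  have hn : (shiftPoly τ a ^ n) q = q := by
    apply (shiftPoly τ a ^ m).injective
    rw [← RingAut.mul_apply, ← zpow_natCast, ← zpow_add]
    exact hlm
  have hn0 : n = 0 := by_contra fun h => ht.shiftPoly_pow_ne_self hq h hn
  simp [hn0]

lemma regularAt_map_iff {q : K[X]} {f : L} :
    RegularAt t (shiftPoly τ a q) (σ f) ↔ RegularAt t q f := by
  constructor
  · rintro ⟨c', d', hd, hf⟩
    obtain ⟨c, rfl⟩ := (shiftPoly τ a).surjective c'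
    obtain ⟨d, rfl⟩ := (shiftPoly τ a).surjective d'
    rw [ht.aeval_shiftPoly, ht.aeval_shiftPoly, ← map_div₀] at hf
    exact ⟨c, d, (map_dvd_iff (shiftPoly τ a)).not.1 hd, σ.injective hf⟩
  · rintro ⟨c, d, hd, rfl⟩
    refine ⟨shiftPoly τ a c, shiftPoly τ a d, (map_dvd_iff (shiftPoly τ a)).not.2 hd, ?_⟩
    rw [ht.aeval_shiftPoly, ht.aeval_shiftPoly, map_div₀]

lemma finite_setOf_not_regularAt_shiftPoly_zpow {c d : K[X]} (hd : d ≠ 0) {q : K[X]}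
    (hqm : q.Monic) (hqi : Irreducible q) :
    {l : ℤ | ¬ RegularAt t ((shiftPoly τ a ^ l) q) (aeval t c / aeval t d)}.Finite := by
  have hfin : {p : K[X] | p.Monic ∧ p ∣ d}.Finite :=
    Set.finite_coe_iff.1 (@Fintype.finite _ (fintypeSubtypeMonicDvd d hd))
  refine (hfin.preimage (ht.shiftPoly_zpow_injective hqi).injOn).subset fun l hl => ?_
  exact ⟨(monic_shiftPoly_zpow_iff τ a l).2 hqm, by_contra fun hdvd => hl ⟨c, d, hdvd, rfl⟩⟩

/-- In the orbit of a pole `q` of `f`, let `m` and `n` be the largest and the least exponent at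
which `f` has a pole. Then `Δ f` has poles at the exponents `m + 1` and `n`, and these are distinct
members of one orbit. -/
theorem exists_aeval_eq_of_regularAt_sub {S : Set K[X]}
    (hS : ∀ p ∈ S, ∀ l : ℤ, (shiftPoly τ a ^ l) p ∈ S → (shiftPoly τ a ^ l) p = p)
    {c d : K[X]} (hd : d ≠ 0)
    (hreg : ∀ q : K[X], q.Monic → Irreducible q → q ∉ S →
      RegularAt t q (σ (aeval t c / aeval t d) - aeval t c / aeval t d)) :
    ∃ p : K[X], aeval t p = aeval t c / aeval t d := by
  refine exists_aeval_eq_of_regularAt ht.transcendental hd fun q hqm hqi => by_contra fun hq => ?_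
  have hfin := ht.finite_setOf_not_regularAt_shiftPoly_zpow (c := c) hd hqm hqi
  set f := aeval t c / aeval t d
  have hne : {l : ℤ | ¬ RegularAt t ((shiftPoly τ a ^ l) q) f}.Nonempty := ⟨0, by simpa using hq⟩
  obtain ⟨m, hm, hmax⟩ := Set.exists_max_image _ id hfin hne
  obtain ⟨n, hn, hmin⟩ := Set.exists_min_image _ id hfin hne
  have hprime (l : ℤ) : Prime ((shiftPoly τ a ^ l) q) :=
    ((irreducible_shiftPoly_zpow_iff τ a l).2 hqi).prime
  have hΔ (l : ℤ) (hl : (shiftPoly τ a ^ l) q ∉ S) :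
      RegularAt t ((shiftPoly τ a ^ l) q) (σ f - f) :=
    hreg _ ((monic_shiftPoly_zpow_iff τ a l).2 hqm) (hprime l).irreducible hl
  have hσ (l : ℤ) : RegularAt t ((shiftPoly τ a ^ (l + 1)) q) (σ f) ↔
      RegularAt t ((shiftPoly τ a ^ l) q) f := by
    rw [← shiftPoly_shiftPoly_zpow, ht.regularAt_map_iff]
  have hmS : (shiftPoly τ a ^ (m + 1)) q ∈ S := by
    by_contra hnot
    have hf : RegularAt t ((shiftPoly τ a ^ (m + 1)) q) f := by_contra fun h => by
      simpa using hmax _ h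
    exact hm ((hσ m).1 (by simpa using (hΔ _ hnot).add ht.transcendental (hprime _) hf))
  have hnS : (shiftPoly τ a ^ n) q ∈ S := by
    by_contra hnot
    have hf : RegularAt t ((shiftPoly τ a ^ (n - 1)) q) f := by_contra fun h => by
      simpa using hmin _ h
    have hσf := (hσ (n - 1)).2 hf
    rw [sub_add_cancel] at hσf
    exact hn (by simpa using hσf.sub ht.transcendental (hprime n) (hΔ n hnot))
  have hcomp : (shiftPoly τ a ^ (m + 1 - n)) ((shiftPoly τ a ^ n) q) =
      (shiftPoly τ a ^ (m + 1)) q := by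
    rw [← RingAut.mul_apply, ← zpow_add, sub_add_cancel]
  have heq : m + 1 = n := ht.shiftPoly_zpow_injective hqi <|
    hcomp.symm.trans (hS _ hnS _ (by rwa [hcomp]))
  exact absurd (hmax n hn) (by simp only [id]; omega)

end IsSigmaMonomial

/-! ### Partial fractions -/

/-- The partial fractions of `K(t)`: the powers of `t` and the elements `t^k / q^j` with `q` monic
irreducible, `k < deg q` and `1 ≤ j`. -/
def partialFractionSet (K : Type*) {L : Type*} [Field K] [Field L] [Algebra K L] (t : L) : Set L :=
  {x | (∃ k : ℕ, x = t ^ k) ∨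
    ∃ (q : K[X]) (k j : ℕ), q.Monic ∧ Irreducible q ∧ k < q.natDegree ∧ 1 ≤ j ∧
      x = t ^ k / aeval t q ^ j}

/-- The indices of the partial fractions; the exponent `j` of the denominator in `t^k / q^j` is
stored as `j - 1`. -/
abbrev PartialFractionIndex (K : Type*) [Field K] : Type _ :=
  ℕ ⊕ (Σ q : {q : K[X] // q.Monic ∧ Irreducible q}, ℕ × Fin q.1.natDegree)

/-- The partial fractions as a family, so that their linear independence can be discussed. -/
def partialFraction (K : Type*) {L : Type*} [Field K] [Field L] [Algebra K L] (t : L) :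
    PartialFractionIndex K → L
  | .inl k => t ^ k
  | .inr x => t ^ (x.2.2 : ℕ) * (aeval t x.1.1)⁻¹ ^ (x.2.1 + 1)

/-- The finitely many indices of partial fractions with powers `t^k`, `k < M`, and denominators
`q^j`, `q ∈ S`, `j ≤ N`. -/
def partialFractionBox {K : Type*} [Field K] (M N : ℕ)
    (S : Finset {q : K[X] // q.Monic ∧ Irreducible q}) : Finset (PartialFractionIndex K) :=
  (Finset.range M).disjSum (S.sigma fun _ => Finset.range N ×ˢ Finset.univ)

section PartialFraction

variable {K L : Type*} [Field K] [Field L] [Algebra K L] {t : L}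

lemma range_partialFraction : Set.range (partialFraction K t) = partialFractionSet K t := by
  ext x
  constructor
  · rintro ⟨k | ⟨⟨q, hqm, hqi⟩, j, k⟩, rfl⟩
    · exact Or.inl ⟨k, rfl⟩
    · exact Or.inr ⟨q, k, j + 1, hqm, hqi, k.2, by omega, by
        simp only [partialFraction, inv_pow, div_eq_mul_inv]⟩
  · rintro (⟨k, rfl⟩ | ⟨q, k, j, hqm, hqi, hk, hj, rfl⟩)
    · exact ⟨.inl k, rfl⟩
    · exact ⟨.inr ⟨⟨q, hqm, hqi⟩, j - 1, ⟨k, hk⟩⟩, by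
        simp only [partialFraction, inv_pow, div_eq_mul_inv, Nat.sub_add_cancel hj]⟩

lemma isCoprime_of_monic_irreducible {p q : K[X]} (hp : p.Monic ∧ Irreducible p)
    (hq : q.Monic ∧ Irreducible q) (hpq : p ≠ q) : IsCoprime p q :=
  (EuclideanDomain.dvd_or_coprime p q hp.2).resolve_left fun hd =>
    hpq (eq_of_monic_of_associated hp.1 hq.1 (hp.2.associated_of_dvd hq.2 hd))

lemma exists_subset_partialFractionBox (s : Finset (PartialFractionIndex K)) :
    ∃ M N S, s ⊆ partialFractionBox M N S := by
  classical
  refine ⟨s.toLeft.sup id + 1, s.toRight.sup (fun y => y.2.1) + 1, s.toRight.image Sigma.fst, ?_⟩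
  rintro (k | y) hx
  · simpa [partialFractionBox, Nat.lt_succ_iff] using
      Finset.le_sup (f := id) (Finset.mem_toLeft.2 hx)
  · have hy := Finset.mem_toRight.2 hx
    simpa [partialFractionBox, Nat.lt_succ_iff] using
      And.intro ⟨y.2.1, y.2.2, hx⟩ (Finset.le_sup (f := fun y => y.2.1) hy)

lemma sum_smul_partialFraction (c : PartialFractionIndex K → K) (M N : ℕ)
    (S : Finset {q : K[X] // q.Monic ∧ Irreducible q}) :
    ∑ x ∈ partialFractionBox M N S, c x • partialFraction K t x =
      aeval t (∑ k ∈ Finset.range M, C (c (.inl k)) * X ^ k) +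
        ∑ q ∈ S, ∑ j : Fin N,
          aeval t (∑ k : Fin q.1.natDegree, C (c (.inr ⟨q, j, k⟩)) * X ^ (k : ℕ)) *
            (aeval t q.1)⁻¹ ^ ((j : ℕ) + 1) := by
  rw [partialFractionBox, Finset.sum_disjSum, Finset.sum_sigma]
  congr 1
  · simp only [partialFraction, map_sum, map_mul, map_pow, aeval_C, aeval_X, Algebra.smul_def]
  · refine Finset.sum_congr rfl fun q _ => ?_
    rw [Finset.sum_product, Finset.sum_range]
    simp only [partialFraction, map_sum, map_mul, map_pow, aeval_C, aeval_X, Algebra.smul_def,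
      Finset.sum_mul, mul_assoc]

lemma eq_zero_of_sum_smul_partialFraction_eq_zero (ht : Transcendental K t)
    {c : PartialFractionIndex K → K} {M N : ℕ} {S : Finset {q : K[X] // q.Monic ∧ Irreducible q}}
    (hc : ∑ x ∈ partialFractionBox M N S, c x • partialFraction K t x = 0) :
    ∀ x ∈ partialFractionBox M N S, c x = 0 := by
  let _ : Algebra K[X] L := (aeval t : K[X] →ₐ[K] L).toAlgebra
  have _ : FaithfulSMul K[X] L :=
    (faithfulSMul_iff_algebraMap_injective K[X] L).2 (transcendental_iff_injective.1 ht)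
  rw [sum_smul_partialFraction] at hc
  obtain ⟨hpoly, hrem⟩ := quo_add_sum_rem_mul_pow_inverse_unique (R := K) (K := L) (s := S)
    (g := fun q => q.1) (n := fun _ => N) (gi := fun q => (aeval t q.1)⁻¹)
    (q₁ := ∑ k ∈ Finset.range M, C (c (.inl k)) * X ^ k) (q₂ := 0)
    (r₁ := fun q j => ∑ k : Fin q.1.natDegree, C (c (.inr ⟨q, j, k⟩)) * X ^ (k : ℕ))
    (r₂ := fun _ _ => 0)
    (fun q _ => q.2.1)
    (fun p _ q _ hpq => isCoprime_of_monic_irreducible p.2 q.2 fun h => hpq (Subtype.ext h))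
    (fun q _ => inv_mul_cancel₀ (aeval_ne_zero_of_transcendental ht q.2.2.ne_zero))
    (fun q _ _ => (degree_sum_fin_lt _).trans_eq (degree_eq_natDegree q.2.2.ne_zero).symm)
    (fun q _ _ => by
      simpa only [degree_zero, bot_lt_iff_ne_bot, ne_eq, degree_eq_bot] using q.2.2.ne_zero)
    (by simp only [map_zero, zero_mul, Finset.sum_const_zero, add_zero]; exact hc)
  rintro (k | ⟨q, j, k⟩) hx
  · have hk := congrArg (fun p => coeff p k) hpoly
    simpa [finsetSum_coeff, coeff_C_mul_X_pow, show k < M by simpa [partialFractionBox] using hx]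
      using hk
  · have hqj : q ∈ S ∧ j < N := by simpa [partialFractionBox] using hx
    have hk := congrArg (fun p => coeff p (k : ℕ)) (congrFun (hrem q hqj.1) ⟨j, hqj.2⟩)
    simpa [finsetSum_coeff, coeff_C_mul_X_pow, Fin.val_inj] using hk

theorem linearIndependent_partialFraction (ht : Transcendental K t) :
    LinearIndependent K (partialFraction K t) := by
  refine linearIndependent_iff''.2 fun s c hcs hc x => ?_
  by_cases hx : x ∈ s
  · obtain ⟨M, N, S, hs⟩ := exists_subset_partialFractionBox s
    refine eq_zero_of_sum_smul_partialFraction_eq_zero ht ?_ x (hs hx)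
    rw [← hc]
    exact (Finset.sum_subset hs fun y _ hy => by rw [hcs y hy, zero_smul]).symm
  · exact hcs x hx

theorem linearIndepOn_partialFractionSet (ht : Transcendental K t) :
    LinearIndepOn K id (partialFractionSet K t) := by
  rw [← range_partialFraction]
  exact (linearIndependent_partialFraction ht).linearIndepOn_id

lemma aeval_mem_span_partialFractionSet (p : K[X]) :
    aeval t p ∈ Submodule.span K (partialFractionSet K t) := by
  rw [aeval_eq_sum_range]
  exact Submodule.sum_mem _ fun k _ =>
    Submodule.smul_mem _ _ (Submodule.subset_span (Or.inl ⟨k, rfl⟩))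

lemma aeval_mul_inv_pow_mem_span_partialFractionSet {q r : K[X]} (hqm : q.Monic)
    (hqi : Irreducible q) (hr : r.degree < q.degree) (j : ℕ) :
    aeval t r * (aeval t q)⁻¹ ^ (j + 1) ∈ Submodule.span K (partialFractionSet K t) := by
  have hdeg : r.natDegree < q.natDegree := by
    rcases eq_or_ne r 0 with rfl | hr0
    · exact natDegree_zero.trans_lt hqi.natDegree_pos
    · exact natDegree_lt_natDegree hr0 hr
  rw [aeval_eq_sum_range, Finset.sum_mul]
  refine Submodule.sum_mem _ fun k hk => ?_
  rw [smul_mul_assoc]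
  have hk' : k < q.natDegree := (Finset.mem_range_succ_iff.1 hk).trans_lt hdeg
  exact Submodule.smul_mem _ _ (Submodule.subset_span (Or.inr ⟨q, k, j + 1, hqm, hqi, hk',
    by omega, by rw [inv_pow, div_eq_mul_inv]⟩))

lemma aeval_div_multiset_prod_mem_span_partialFractionSet (ht : Transcendental K t) (a : K[X])
    {m : Multiset K[X]} (hm : ∀ q ∈ m, q.Monic ∧ Irreducible q) :
    aeval t a / aeval t m.prod ∈ Submodule.span K (partialFractionSet K t) := by
  classical
  let _ : Algebra K[X] L := (aeval t : K[X] →ₐ[K] L).toAlgebra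
  have hm' (q : K[X]) (hq : q ∈ m.toFinset) : q.Monic ∧ Irreducible q :=
    hm q (Multiset.mem_toFinset.1 hq)
  obtain ⟨p, r, hr, hp⟩ := mul_prod_pow_inverse_eq_quo_add_sum_rem_mul_pow_inverse (K := L)
    (s := m.toFinset) a (g := id) (fun q hq => (hm' q hq).1)
    (fun p hp q hq hpq => isCoprime_of_monic_irreducible (hm' p hp) (hm' q hq) hpq)
    (fun q => m.count q) (gi := fun q => (aeval t q)⁻¹)
    (fun q hq => inv_mul_cancel₀ (aeval_ne_zero_of_transcendental ht (hm' q hq).2.ne_zero))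
  have hprod : ∏ q ∈ m.toFinset, (aeval t q)⁻¹ ^ m.count q = (aeval t m.prod)⁻¹ := by
    simp only [Finset.prod_multiset_count m, map_prod, map_pow, inv_pow, Finset.prod_inv_distrib]
  rw [div_eq_mul_inv, ← hprod]
  change algebraMap K[X] L a * _ ∈ _
  rw [hp]
  exact Submodule.add_mem _ (aeval_mem_span_partialFractionSet p)
    (Submodule.sum_mem _ fun q hq => Submodule.sum_mem _ fun j _ =>
      aeval_mul_inv_pow_mem_span_partialFractionSet (hm' q hq).1 (hm' q hq).2 (hr q hq j) j)

lemma aeval_div_mem_span_partialFractionSet (ht : Transcendental K t) (a : K[X]) {b : K[X]}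
    (hb : b ≠ 0) : aeval t a / aeval t b ∈ Submodule.span K (partialFractionSet K t) := by
  classical
  have hfac (q : K[X]) (hq : q ∈ UniqueFactorizationMonoid.normalizedFactors b) :
      q.Monic ∧ Irreducible q := by
    rw [UniqueFactorizationMonoid.mem_normalizedFactors_iff' hb] at hq
    exact ⟨hq.2.1 ▸ monic_normalize hq.1.ne_zero, hq.1⟩
  obtain ⟨u, hu⟩ := UniqueFactorizationMonoid.prod_normalizedFactors hb
  have hu0 : aeval t (u : K[X]) ≠ 0 := aeval_ne_zero_of_transcendental ht u.ne_zero
  have hab : aeval t a / aeval t b = aeval t (a * (↑u⁻¹ : K[X])) /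
      aeval t (UniqueFactorizationMonoid.normalizedFactors b).prod := by
    rw [← mul_div_mul_right (aeval t (a * _)) _ hu0, ← map_mul, ← map_mul,
      Units.inv_mul_cancel_right, hu]
  rw [hab]
  exact aeval_div_multiset_prod_mem_span_partialFractionSet ht _ hfac

theorem span_partialFractionSet (ht : Transcendental K t) :
    Submodule.span K (partialFractionSet K t) =
      Subalgebra.toSubmodule (IntermediateField.adjoin K {t}).toSubalgebra := by
  apply le_antisymm
  · have htm : t ∈ IntermediateField.adjoin K {t} := IntermediateField.mem_adjoin_simple_self K t
    have hp (p : K[X]) : aeval t p ∈ IntermediateField.adjoin K {t} :=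
      IntermediateField.algebra_adjoin_le_adjoin K _ (aeval_mem_adjoin_singleton K t)
    rw [Submodule.span_le]
    rintro x (⟨k, rfl⟩ | ⟨q, k, j, -, -, -, -, rfl⟩)
    all_goals change _ ∈ IntermediateField.adjoin K {t}
    · exact pow_mem htm k
    · exact div_mem (pow_mem htm k) (pow_mem (hp q) j)
  · intro x hx
    obtain ⟨r, s, rfl⟩ := (IntermediateField.mem_adjoin_simple_iff K x).1 hx
    by_cases hs : s = 0
    · simp [hs]
    · exact aeval_div_mem_span_partialFractionSet ht r hs

end PartialFraction

/-! ### Towers and their canonical bases -/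

section LinearAlgebra

lemma span_setOf_coe_mem {C V : Type*} [Semiring C] [AddCommMonoid V] [Module C V]
    {U : Submodule C V} {B : Set V} (hB : B ⊆ U) :
    Submodule.span C {ξ : U | (ξ : V) ∈ B} = (Submodule.span C B).submoduleOf U := by
  apply Submodule.map_injective_of_injective U.injective_subtype
  rw [Submodule.map_span, Submodule.submoduleOf, Submodule.map_comap_subtype,
    inf_eq_right.2 (Submodule.span_le.2 hB)]
  congr 1
  exact (Subtype.image_preimage_coe (U : Set V) B).trans (Set.inter_eq_right.2 hB)

lemma linearIndepOn_setOf_coe_mem {C V : Type*} [Semiring C] [AddCommMonoid V] [Module C V]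
    {U : Submodule C V} {B : Set V} (hB : LinearIndepOn C id B) :
    LinearIndepOn C id {ξ : U | (ξ : V) ∈ B} := by
  have hinj : Function.Injective (fun ξ : {ξ : U | (ξ : V) ∈ B} => (⟨ξ.1, ξ.2⟩ : B)) :=
    fun x y hxy => Subtype.ext (Subtype.ext (congrArg (fun z : B => (z : V)) hxy))
  exact LinearIndependent.of_comp U.subtype (LinearIndependent.comp hB _ hinj)

open scoped Pointwise in
lemma linearIndepOn_id_smul {R S A : Type*} [Semiring R] [Semiring S] [AddCommMonoid A]
    [Module R S] [Module S A] [Module R A] [IsScalarTower R S A] {s : Set S} {t : Set A}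
    (hs : LinearIndepOn R id s) (ht : LinearIndepOn S id t) : LinearIndepOn R id (s • t) := by
  have h := (linearIndependent_smul hs ht).linearIndepOn_id
  convert h using 1
  ext x
  simp [Set.mem_smul]

end LinearAlgebra

lemma map_mem_of_mem_fieldAdjoin {F L : Type*} [Field F] [Field L] [Algebra F L] {s : Set L}
    {K : Subfield L} (f : L →+* L) (hF : ∀ a : F, f (algebraMap F L a) ∈ K)
    (hs : ∀ x ∈ s, f x ∈ K) {x : L} (hx : x ∈ IntermediateField.adjoin F s) : f x ∈ K := by
  have hle : Set.range (algebraMap F L) ∪ s ⊆ K.comap f :=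
    Set.union_subset (Set.range_subset_iff.2 hF) hs
  exact Subfield.closure_le.2 hle hx

lemma map_mem_of_mem_algebraAdjoin {F L : Type*} [CommSemiring F] [Semiring L] [Algebra F L]
    {s : Set L} {K : Subsemiring L} (f : L →+* L) (hF : ∀ a : F, f (algebraMap F L a) ∈ K)
    (hs : ∀ x ∈ s, f x ∈ K) {x : L} (hx : x ∈ Algebra.adjoin F s) : f x ∈ K := by
  have hle : Set.range (algebraMap F L) ∪ s ⊆ K.comap f :=
    Set.union_subset (Set.range_subset_iff.2 hF) hs
  exact Subsemiring.closure_le.2 hle hx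

namespace SigmaTower

variable {F₀ : Type u} {L : Type v} [Field F₀] [Field L] [Algebra F₀ L] {n : ℕ}
  (T : SigmaTower F₀ L n)

lemma Δ_apply (f : L) : T.Δ f = T.σ f - f := rfl

lemma smul_eq (c : T.C) (x : L) : c • x = algebraMap F₀ L (c : F₀) * x :=
  Algebra.smul_def (c : F₀) x

lemma exists_C_of_σ_eq {x : L} (hx : T.σ x = x) :
    ∃ c : T.C, algebraMap F₀ L (c : F₀) = x := by
  obtain ⟨c, rfl⟩ := T.const_eq x hx
  rw [T.σ_algebraMap] at hx
  exact ⟨⟨c, (algebraMap F₀ L).injective hx⟩, rfl⟩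

lemma σ_coe_C (c : T.C) : T.σ (algebraMap F₀ L (c : F₀)) = algebraMap F₀ L (c : F₀) := by
  rw [T.σ_algebraMap, show T.σ₀ (c : F₀) = c from c.2]

lemma towerField_mono {i j : ℕ} (h : i ≤ j) : towerField F₀ T.t i ≤ towerField F₀ T.t j :=
  IntermediateField.adjoin.mono _ _ _ (Set.image_mono fun _ hk => lt_of_lt_of_le hk h)

lemma towerRing_mono {i j : ℕ} (h : i ≤ j) : towerRing F₀ T.t i ≤ towerRing F₀ T.t j :=
  Algebra.adjoin_mono (Set.image_mono fun _ hk => lt_of_lt_of_le hk h)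

lemma towerRing_le_towerField (i : ℕ) :
    towerRing F₀ T.t i ≤ (towerField F₀ T.t i).toSubalgebra :=
  IntermediateField.algebra_adjoin_le_adjoin F₀ _

lemma gen_mem_towerRing {i j : ℕ} (h : i < j) : T.t i ∈ towerRing F₀ T.t j :=
  Algebra.subset_adjoin ⟨i, h, rfl⟩

lemma gen_mem_towerField {i j : ℕ} (h : i < j) : T.t i ∈ towerField F₀ T.t j :=
  T.towerRing_le_towerField j (T.gen_mem_towerRing h)

lemma image_gen_succ (i : ℕ) : T.t '' {j | j < i + 1} = T.t '' {j | j < i} ∪ {T.t i} := by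
  rw [Set.union_singleton, ← Set.image_insert_eq]
  congr 1
  ext j
  simp only [Set.mem_ofPred_eq, Set.mem_insert_iff]
  omega

lemma towerField_succ (i : ℕ) :
    towerField F₀ T.t (i + 1) =
      (IntermediateField.adjoin (towerField F₀ T.t i) {T.t i}).restrictScalars F₀ := by
  rw [towerField, towerField, IntermediateField.adjoin_adjoin_left, image_gen_succ]

lemma towerRing_succ (i : ℕ) :
    towerRing F₀ T.t (i + 1) =
      (Algebra.adjoin (towerRing F₀ T.t i) {T.t i}).restrictScalars F₀ := by
  rw [towerRing, towerRing, ← Algebra.adjoin_union_eq_adjoin_adjoin, image_gen_succ]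

lemma mem_towerField_succ {i : ℕ} {x : L} :
    x ∈ towerField F₀ T.t (i + 1) ↔
      x ∈ IntermediateField.adjoin (towerField F₀ T.t i) {T.t i} := by
  rw [towerField_succ, IntermediateField.mem_restrictScalars]

lemma aeval_mem_towerField_succ {i : ℕ} (p : (towerField F₀ T.t i)[X]) :
    aeval (T.t i) p ∈ towerField F₀ T.t (i + 1) :=
  T.mem_towerField_succ.2 <|
    IntermediateField.algebra_adjoin_le_adjoin _ _ (aeval_mem_adjoin_singleton _ _)

lemma exists_div_of_mem_towerField_succ {i : ℕ} {x : L} (hx : x ∈ towerField F₀ T.t (i + 1)) :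
    ∃ a b : (towerField F₀ T.t i)[X], b ≠ 0 ∧ x = aeval (T.t i) a / aeval (T.t i) b := by
  obtain ⟨a, b, rfl⟩ :=
    (IntermediateField.mem_adjoin_simple_iff _ _).1 (T.mem_towerField_succ.1 hx)
  by_cases hb : b = 0
  · exact ⟨0, 1, one_ne_zero, by simp [hb]⟩
  · exact ⟨a, b, hb, rfl⟩

/-- The subring `A ∩ F_i` of `F_i`, where the coefficients of polynomials in `t_{i+1}` are taken;
the case of interest is `A = E_i`. -/
def interField (A : Subalgebra F₀ L) (i : ℕ) : Subring (towerField F₀ T.t i) :=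
  A.toSubring.comap (towerField F₀ T.t i).val.toRingHom

lemma mem_towerRing_succ {i : ℕ} {x : L} :
    x ∈ towerRing F₀ T.t (i + 1) ↔
      ∃ p ∈ coeffsIn (T.interField (towerRing F₀ T.t i) i).toAddSubgroup,
        aeval (T.t i) p = x := by
  constructor
  · intro hx
    rw [towerRing_succ, Subalgebra.mem_restrictScalars, Algebra.adjoin_singleton_eq_range_aeval]
      at hx
    obtain ⟨p, rfl⟩ := hx
    refine ⟨p.map (Subalgebra.inclusion (T.towerRing_le_towerField i)).toRingHom, fun k => ?_, ?_⟩
    · rw [coeff_map]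
      exact (p.coeff k).2
    · rw [aeval_def, eval₂_map]
      rfl
  · rintro ⟨p, hp, rfl⟩
    rw [aeval_eq_sum_range]
    exact sum_mem fun k _ => mul_mem (T.towerRing_mono (Nat.le_succ i) (hp k))
      (pow_mem (T.gen_mem_towerRing (Nat.lt_succ_self i)) k)

lemma σ_mem_towerField {i : ℕ} (hi : i ≤ n) {x : L} (hx : x ∈ towerField F₀ T.t i) :
    T.σ x ∈ towerField F₀ T.t i := by
  refine map_mem_of_mem_fieldAdjoin (K := (towerField F₀ T.t i).toSubfield) T.σ.toRingHom
    (fun a => ?_) ?_ hx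
  · exact (T.σ_algebraMap a).symm ▸ (towerField F₀ T.t i).algebraMap_mem _
  · rintro _ ⟨j, hj : j < i, rfl⟩
    rw [← sub_add_cancel (T.σ.toRingHom (T.t j)) (T.t j)]
    exact add_mem (T.towerField_mono hj.le (T.diff_mem j (hj.trans_le hi)))
      (T.gen_mem_towerField hj)

lemma σ_symm_algebraMap (a : F₀) :
    T.σ.symm (algebraMap F₀ L a) = algebraMap F₀ L (T.σ₀.symm a) := by
  rw [RingEquiv.symm_apply_eq, T.σ_algebraMap, RingEquiv.apply_symm_apply]

lemma σ_symm_mem_towerField {i : ℕ} (hi : i ≤ n) {x : L} (hx : x ∈ towerField F₀ T.t i) :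
    T.σ.symm x ∈ towerField F₀ T.t i := by
  induction i using Nat.strong_induction_on generalizing x with
  | _ i ih =>
    refine map_mem_of_mem_fieldAdjoin (K := (towerField F₀ T.t i).toSubfield)
      T.σ.symm.toRingHom (fun a => ?_) ?_ hx
    · exact (T.σ_symm_algebraMap a).symm ▸ (towerField F₀ T.t i).algebraMap_mem _
    · rintro _ ⟨j, hj : j < i, rfl⟩
      have hjn : j < n := hj.trans_le hi
      have hsub : T.σ.symm (T.t j) = T.t j - T.σ.symm (T.σ (T.t j) - T.t j) := by
        rw [map_sub, RingEquiv.symm_apply_apply, sub_sub_cancel]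
      change T.σ.symm (T.t j) ∈ towerField F₀ T.t i
      rw [hsub]
      exact sub_mem (T.gen_mem_towerField hj)
        (T.towerField_mono hj.le (ih j hj hjn.le (T.diff_mem j hjn)))

lemma σ_mem_towerRing (hT : T.IsRingTower) {i : ℕ} (hi : i ≤ n) {x : L}
    (hx : x ∈ towerRing F₀ T.t i) : T.σ x ∈ towerRing F₀ T.t i := by
  refine map_mem_of_mem_algebraAdjoin (K := (towerRing F₀ T.t i).toSubsemiring) T.σ.toRingHom
    (fun a => ?_) ?_ hx
  · exact (T.σ_algebraMap a).symm ▸ (towerRing F₀ T.t i).algebraMap_mem _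
  · rintro _ ⟨j, hj : j < i, rfl⟩
    rw [← sub_add_cancel (T.σ.toRingHom (T.t j)) (T.t j)]
    exact add_mem (T.towerRing_mono hj.le (hT j (hj.trans_le hi))) (T.gen_mem_towerRing hj)

lemma Δ_mem_fieldSpace {i : ℕ} (hi : i ≤ n) {x : L} (hx : x ∈ T.fieldSpace i) :
    T.Δ x ∈ T.fieldSpace i :=
  sub_mem (H := towerField F₀ T.t i) (T.σ_mem_towerField hi hx) hx

lemma Δ_mem_ringSpace (hT : T.IsRingTower) {i : ℕ} (hi : i ≤ n) {x : L}
    (hx : x ∈ T.ringSpace i) : T.Δ x ∈ T.ringSpace i :=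
  sub_mem (H := towerRing F₀ T.t i) (T.σ_mem_towerRing hT hi hx) hx

/-- The automorphism of `F_i` obtained by restricting `σ`. -/
def σField (i : ℕ) (hi : i ≤ n) : towerField F₀ T.t i ≃+* towerField F₀ T.t i where
  toFun x := ⟨T.σ x, T.σ_mem_towerField hi x.2⟩
  invFun x := ⟨T.σ.symm x, T.σ_symm_mem_towerField hi x.2⟩
  left_inv x := Subtype.ext (T.σ.symm_apply_apply x)
  right_inv x := Subtype.ext (T.σ.apply_symm_apply x)
  map_mul' x y := Subtype.ext (map_mul T.σ (x : L) y)
  map_add' x y := Subtype.ext (map_add T.σ (x : L) y)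

lemma isSigmaMonomial (i : ℕ) (hi : i < n) :
    IsSigmaMonomial T.σ (T.σField i hi.le) (T.t i)
      (⟨T.Δ (T.t i), T.diff_mem i hi⟩ : towerField F₀ T.t i) where
  transcendental := T.transcendental i hi
  map_algebraMap _ := rfl
  map_gen := (add_sub_cancel (T.t i) (T.σ (T.t i))).symm
  exists_algebraMap_eq x hx := by
    obtain ⟨c, rfl⟩ := T.const_eq x hx
    exact ⟨algebraMap F₀ _ c, rfl⟩

lemma canonicalStep_eq (i : ℕ) :
    T.canonicalStep i = partialFractionSet (towerField F₀ T.t i) (T.t i) := rfl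

lemma canonicalStep_subset (i : ℕ) {η : L} (hη : η ∈ T.canonicalStep i) :
    η ∈ towerField F₀ T.t (i + 1) := by
  have ht := T.gen_mem_towerField (Nat.lt_succ_self i)
  rcases hη with ⟨k, rfl⟩ | ⟨q, k, j, -, -, -, -, rfl⟩
  · exact pow_mem ht k
  · exact div_mem (pow_mem ht k) (pow_mem (T.aeval_mem_towerField_succ q) j)

lemma canonicalBasis_subset (Θ₀ : Set F₀) (i : ℕ) {ξ : L} (hξ : ξ ∈ T.canonicalBasis Θ₀ i) :
    ξ ∈ T.fieldSpace i := by
  induction i generalizing ξ with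
  | zero =>
    obtain ⟨a, -, rfl⟩ := hξ
    exact (T.mem_fieldSpace_zero _).2 ⟨a, rfl⟩
  | succ i ih =>
    obtain ⟨ξ, hξ, η, hη, rfl⟩ := hξ
    exact mul_mem (S := IntermediateField F₀ L) (T.towerField_mono (Nat.le_succ i) (ih hξ))
      (T.canonicalStep_subset i hη)

lemma canonicalBasis_mono (Θ₀ : Set F₀) : Monotone (T.canonicalBasis Θ₀) :=
  monotone_nat_of_le_succ fun _ ξ hξ =>
    ⟨ξ, hξ, 1, Or.inl ⟨0, (pow_zero _).symm⟩, (mul_one ξ).symm⟩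

open scoped Pointwise in
lemma canonicalBasis_succ_eq_smul (Θ₀ : Set F₀) (i : ℕ) :
    T.canonicalBasis Θ₀ (i + 1) =
      {ξ : towerField F₀ T.t i | (ξ : L) ∈ T.canonicalBasis Θ₀ i} • T.canonicalStep i := by
  ext x
  constructor
  · rintro ⟨ξ, hξ, η, hη, rfl⟩
    exact ⟨⟨ξ, T.canonicalBasis_subset Θ₀ i hξ⟩, hξ, η, hη, rfl⟩
  · rintro ⟨ξ, hξ, η, hη, rfl⟩
    exact ⟨ξ, hξ, η, hη, rfl⟩

lemma span_canonicalBasis {ι : Type w} (b : Module.Basis ι T.C F₀) {i : ℕ} (hi : i ≤ n) :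
    Submodule.span T.C (T.canonicalBasis (Set.range b) i) = T.fieldSpace i := by
  induction i with
  | zero =>
    have hspan := congrArg (Submodule.map ((Algebra.linearMap F₀ L).restrictScalars T.C)) b.span_eq
    rw [Submodule.map_span] at hspan
    refine hspan.trans (Submodule.ext fun x => ?_)
    simp [mem_fieldSpace_zero]
  | succ i ih =>
    have hspan : Submodule.span T.C
        {ξ : towerField F₀ T.t i | (ξ : L) ∈ T.canonicalBasis (Set.range b) i} = ⊤ := by
      have h := span_setOf_coe_mem (U := T.fieldSpace i)
        fun _ => T.canonicalBasis_subset (Set.range b) i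
      rw [ih (Nat.le_of_succ_le hi), Submodule.submoduleOf_self] at h
      exact h
    rw [canonicalBasis_succ_eq_smul, Submodule.span_smul_of_span_eq_top hspan, canonicalStep_eq,
      span_partialFractionSet (T.transcendental i hi)]
    ext x
    exact T.mem_towerField_succ.symm

lemma linearIndepOn_canonicalBasis {ι : Type w} (b : Module.Basis ι T.C F₀) {i : ℕ} (hi : i ≤ n) :
    LinearIndepOn T.C id (T.canonicalBasis (Set.range b) i) := by
  induction i with
  | zero =>
    have h : LinearIndependent T.C (fun k => algebraMap F₀ L (b k)) :=
      b.linearIndependent.map' ((Algebra.linearMap F₀ L).restrictScalars T.C)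
        (LinearMap.ker_eq_bot.2 (algebraMap F₀ L).injective)
    have h' := h.linearIndepOn_id
    rwa [Set.range_comp' (algebraMap F₀ L) b] at h'
  | succ i ih =>
    have h : LinearIndepOn T.C id
        {ξ : towerField F₀ T.t i | (ξ : L) ∈ T.canonicalBasis (Set.range b) i} :=
      linearIndepOn_setOf_coe_mem (U := T.fieldSpace i) (ih (Nat.le_of_succ_le hi))
    rw [canonicalBasis_succ_eq_smul]
    exact linearIndepOn_id_smul h (linearIndepOn_partialFractionSet (T.transcendental i hi))

end SigmaTower

section LinearAlgebra

variable {C : Type u} {V : Type v} [Field C] [AddCommGroup V] [Module C V]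

lemma coordFunctional_spec {B : Set V} (hB : LinearIndepOn C id B) {θ : V} (hθ : θ ∈ B) :
    coordFunctional (C := C) B θ θ = 1 ∧
      ∀ ξ ∈ B, ξ ≠ θ → coordFunctional (C := C) B θ ξ = 0 := by
  classical
  have hex : ∃ l : V →ₗ[C] C, l θ = 1 ∧ ∀ ξ ∈ B, ξ ≠ θ → l ξ = 0 := by
    let l : V →ₗ[C] C := (Module.Basis.extend hB).constr C fun ξ => if (ξ : V) = θ then 1 else 0
    have hl : ∀ ξ ∈ B, l ξ = if ξ = θ then 1 else 0 := fun ξ hξ => by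
      have h := (Module.Basis.extend hB).constr_basis C
        (fun ξ => if (ξ : V) = θ then (1 : C) else 0) ⟨ξ, hB.subset_extend _ hξ⟩
      rwa [Module.Basis.extend_apply_self] at h
    exact ⟨l, by rw [hl θ hθ, if_pos rfl], fun ξ hξ hne => by rw [hl ξ hξ, if_neg hne]⟩
  rw [coordFunctional, dif_pos hex]
  exact hex.choose_spec

lemma coordFunctional_finsuppSum {B : Set V} (hB : LinearIndepOn C id B) {θ : V} (hθ : θ ∈ B)
    {c : V →₀ C} (hc : ↑c.support ⊆ B) :
    coordFunctional (C := C) B θ (c.sum fun ξ a => a • ξ) = c θ := by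
  obtain ⟨hself, hne⟩ := coordFunctional_spec hB hθ
  rw [map_finsuppSum, Finsupp.sum, Finset.sum_eq_single θ]
  · rw [map_smul, hself, smul_eq_mul, mul_one]
  · intro ξ hξ hξθ
    rw [map_smul, hne ξ (hc hξ) hξθ, smul_zero]
  · intro hθc
    rw [Finsupp.notMem_support_iff.1 hθc, zero_smul, map_zero]

lemma exists_coordFunctional_ne_zero {B A A' : Set V} (hB : LinearIndepOn C id B) (hA : A ⊆ B)
    {f : V} (hf : f ∈ Submodule.span C A) (hf' : f ∉ Submodule.span C A') :
    ∃ θ ∈ A, θ ∉ A' ∧ coordFunctional (C := C) B θ f ≠ 0 := by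
  by_contra! hzero
  obtain ⟨c, hcA, rfl⟩ := Submodule.mem_span_set.1 hf
  refine hf' (Submodule.sum_mem _ fun θ hθ => Submodule.smul_mem _ _ (Submodule.subset_span ?_))
  by_contra hθ'
  have hcθ := hzero θ (hcA hθ) hθ'
  rw [coordFunctional_finsuppSum hB (hA (hcA hθ)) (hcA.trans hA)] at hcθ
  exact Finsupp.mem_support_iff.1 hθ hcθ

lemma mem_summableSpace {Δ : V →ₗ[C] V} {W : Submodule C V} {f : W} :
    f ∈ summableSpace Δ W ↔ ∃ g ∈ W, Δ g = f :=
  Iff.rfl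

namespace IsCompleteReduction

variable {U : Submodule C V} {φ : V →ₗ[C] V} (h : IsCompleteReduction U φ)
include h

lemma apply_eq_zero_iff {f : V} : φ f = 0 ↔ f ∈ U := by
  rw [← LinearMap.mem_ker, h.ker_eq]

lemma apply_apply (f : V) : φ (φ f) = φ f := by
  have h0 : φ (f - φ f) = 0 := h.apply_eq_zero_iff.2 (h.sub_mem f)
  rw [map_sub, sub_eq_zero] at h0
  exact h0.symm

end IsCompleteReduction

end LinearAlgebra

namespace SigmaTower

variable {F₀ : Type u} {L : Type v} [Field F₀] [Field L] [Algebra F₀ L] {n : ℕ}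
  (T : SigmaTower F₀ L n)

lemma indicator_le {x : L} {i : ℕ} (hx : x ∈ T.fieldSpace i) : T.indicator x ≤ i :=
  Nat.sInf_le hx

lemma mem_fieldSpace_indicator {x : L} {i : ℕ} (hx : x ∈ T.fieldSpace i) :
    x ∈ T.fieldSpace (T.indicator x) :=
  Nat.sInf_mem (s := {j | x ∈ T.fieldSpace j}) ⟨i, hx⟩

section Coord

variable {ι : Type w} (b : Module.Basis ι T.C F₀) {i : ℕ} (hi : i ≤ n)
include hi

lemma canonicalCoord_spec {θ : T.fieldSpace i}
    (hθ : (θ : L) ∈ T.canonicalBasis (Set.range b) i) :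
    T.canonicalCoord (Set.range b) i θ θ = 1 ∧
      ∀ ξ : T.fieldSpace i, (ξ : L) ∈ T.canonicalBasis (Set.range b) i → ξ ≠ θ →
        T.canonicalCoord (Set.range b) i θ ξ = 0 := by
  refine coordFunctional_spec ?_ hθ
  exact linearIndepOn_setOf_coe_mem (T.linearIndepOn_canonicalBasis b hi)

lemma eq_of_eqOn_canonicalBasis {M : Type*} [AddCommMonoid M] [Module T.C M]
    {l l' : T.fieldSpace i →ₗ[T.C] M}
    (h : ∀ ξ : T.fieldSpace i, (ξ : L) ∈ T.canonicalBasis (Set.range b) i → l ξ = l' ξ) :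
    l = l' := by
  have hspan := span_setOf_coe_mem (U := T.fieldSpace i)
    fun _ => T.canonicalBasis_subset (Set.range b) i
  rw [T.span_canonicalBasis b hi, Submodule.submoduleOf_self] at hspan
  exact LinearMap.ext_on hspan h

lemma exists_canonicalCoord_ne_zero {f : T.fieldSpace i} (hf : f ≠ 0) :
    ∃ θ : T.fieldSpace i, (θ : L) ∈ T.canonicalBasis (Set.range b) i ∧
      T.canonicalCoord (Set.range b) i θ f ≠ 0 ∧ T.indicator θ = T.indicator f := by
  obtain ⟨m, hm⟩ : ∃ m, T.indicator (f : L) = m := ⟨_, rfl⟩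
  have hmi : m ≤ i := hm ▸ T.indicator_le f.2
  have hspan : f ∈ Submodule.span T.C
      {ξ : T.fieldSpace i | (ξ : L) ∈ T.canonicalBasis (Set.range b) m} := by
    rw [span_setOf_coe_mem fun ξ hξ => T.towerField_mono hmi (T.canonicalBasis_subset _ m hξ),
      T.span_canonicalBasis b (hmi.trans hi)]
    exact hm ▸ T.mem_fieldSpace_indicator f.2
  have hlow : f ∉ Submodule.span T.C {ξ : T.fieldSpace i | T.indicator (ξ : L) < m} := by
    cases m with
    | zero => simpa using hf
    | succ j =>
      have hle : Submodule.span T.C {ξ : T.fieldSpace i | T.indicator (ξ : L) < j + 1} ≤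
          (T.fieldSpace j).submoduleOf (T.fieldSpace i) :=
        Submodule.span_le.2 fun ξ hξ =>
          T.towerField_mono (Nat.le_of_lt_succ hξ) (T.mem_fieldSpace_indicator ξ.2)
      exact fun hfj => (T.indicator_le (x := (f : L)) (hle hfj)).not_gt (by omega)
  have hindep : LinearIndepOn T.C id
      {ξ : T.fieldSpace i | (ξ : L) ∈ T.canonicalBasis (Set.range b) i} :=
    linearIndepOn_setOf_coe_mem (T.linearIndepOn_canonicalBasis b hi)
  obtain ⟨θ, hθ, hθm, hne⟩ := exists_coordFunctional_ne_zero hindep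
    (fun _ hξ => T.canonicalBasis_mono (Set.range b) hmi hξ) hspan hlow
  exact ⟨θ, T.canonicalBasis_mono _ hmi hθ, hne,
    hm ▸ le_antisymm (T.indicator_le (T.canonicalBasis_subset _ m hθ)) (not_lt.1 hθm)⟩

end Coord

end SigmaTower

/-! ### The complement of the summable space -/

namespace SigmaTower

variable {F₀ : Type u} {L : Type v} [Field F₀] [Field L] [Algebra F₀ L] {n : ℕ}
  (T : SigmaTower F₀ L n)

/-- The group `im φ ∩ ker θ^*` of the coefficients allowed in `V_θ`, where `l = θ^*`. -/
def remainderGroup {i : ℕ} (l : T.fieldSpace i →ₗ[T.C] T.C)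
    (φ : T.fieldSpace i →ₗ[T.C] T.fieldSpace i) : AddSubgroup (towerField F₀ T.t i) :=
  ((LinearMap.range φ ⊓ LinearMap.ker l).map (T.fieldSpace i).subtype).toAddSubgroup.comap
    (towerField F₀ T.t i).val.toRingHom.toAddMonoidHom

/-- The map `φ` splits the elements of `A ∩ F_i` into a summable and a remaining part without
leaving `A`. -/
def SplitsWithin (A : Subalgebra F₀ L) {i : ℕ} (φ : T.fieldSpace i →ₗ[T.C] T.fieldSpace i) :
    Prop :=
  ∀ f : T.fieldSpace i, (f : L) ∈ A → (φ f : L) ∈ A ∧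
    ∃ g ∈ T.fieldSpace i, g ∈ A ∧ T.Δ g = f - φ f

variable {T} in
lemma splitsWithin_of_isCompleteReduction {A : Subalgebra F₀ L} {i : ℕ}
    {φ : T.fieldSpace i →ₗ[T.C] T.fieldSpace i} (hA : T.fieldSpace i ≤
      (Subalgebra.toSubmodule A).restrictScalars T.C)
    (hφ : IsCompleteReduction (summableSpace T.Δ (T.fieldSpace i)) φ) : T.SplitsWithin A φ := by
  intro f _
  obtain ⟨g, hg, hgf⟩ := mem_summableSpace.1 (hφ.sub_mem f)
  exact ⟨hA (φ f).2, g, hg, hA hg, hgf⟩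

/-- The automorphism of `F_i[t_{i+1}]` that extends `σ`. -/
abbrev polyShift (i : ℕ) (hi : i < n) :
    (towerField F₀ T.t i)[X] ≃+* (towerField F₀ T.t i)[X] :=
  shiftPoly (T.σField i hi.le) ⟨T.Δ (T.t i), T.diff_mem i hi⟩

section Step

variable {i : ℕ} {S : Set L} {l : T.fieldSpace i →ₗ[T.C] T.C}
  {φ : T.fieldSpace i →ₗ[T.C] T.fieldSpace i}

lemma smul_mem_remainderGroup (c : T.C) {x : towerField F₀ T.t i}
    (hx : x ∈ T.remainderGroup l φ) :
    algebraMap F₀ (towerField F₀ T.t i) c * x ∈ T.remainderGroup l φ := by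
  have h := Submodule.smul_mem ((LinearMap.range φ ⊓ LinearMap.ker l).map
    (T.fieldSpace i).subtype) c hx
  rw [smul_eq] at h
  exact h

lemma mem_polyComplement_iff {x : L} :
    x ∈ T.polyComplement i l φ ↔
      ∃ r ∈ coeffsIn (T.remainderGroup l φ), aeval (T.t i) r = x := by
  constructor
  · intro hx
    induction hx using Submodule.span_induction with
    | mem x hx =>
      obtain ⟨a, ha, k, rfl⟩ := hx
      have hmem : (⟨a, a.2⟩ : towerField F₀ T.t i) ∈ T.remainderGroup l φ := ⟨a, ha, rfl⟩
      refine ⟨_, C_mul_X_pow_mem_coeffsIn hmem k, ?_⟩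
      rw [map_mul, map_pow, aeval_C, aeval_X]
      rfl
    | zero => exact ⟨0, zero_mem _, map_zero _⟩
    | add x y _ _ hx hy =>
      obtain ⟨r, hr, rfl⟩ := hx
      obtain ⟨s, hs, rfl⟩ := hy
      exact ⟨r + s, add_mem hr hs, map_add _ _ _⟩
    | smul c x _ hx =>
      obtain ⟨r, hr, rfl⟩ := hx
      refine ⟨Polynomial.C (algebraMap F₀ (towerField F₀ T.t i) c) * r, fun k => ?_, ?_⟩
      · rw [coeff_C_mul]
        exact T.smul_mem_remainderGroup c (hr k)
      · rw [map_mul, aeval_C, smul_eq]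
        rfl
  · rintro ⟨r, hr, rfl⟩
    rw [aeval_eq_sum_range]
    refine Submodule.sum_mem _ fun k _ => ?_
    obtain ⟨y, hy, h⟩ := hr k
    refine Submodule.subset_span ⟨y, hy, k, ?_⟩
    rw [Algebra.smul_def]
    exact congrArg (· * T.t i ^ k) h.symm

lemma polyComplement_le : T.polyComplement i l φ ≤ T.fieldSpace (i + 1) := by
  intro x hx
  obtain ⟨r, -, rfl⟩ := T.mem_polyComplement_iff.1 hx
  exact T.aeval_mem_towerField_succ r

variable (hi : i < n)

/-- A suitable multiple of the splitting of `Δ(t_{i+1})` moves the remainder into `ker θ^*`. -/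
lemma exists_eq_Δ_add_smul_add (hl : l (φ (T.diffGen i hi)) ≠ 0) {A : Subalgebra F₀ L}
    (ht : T.Δ (T.t i) ∈ A) (hφ : T.SplitsWithin A φ) {f : T.fieldSpace i} (hf : (f : L) ∈ A) :
    ∃ g ∈ T.fieldSpace i, g ∈ A ∧ ∃ c : T.C, ∃ w ∈ LinearMap.range φ ⊓ LinearMap.ker l,
      (w : L) ∈ A ∧ (f : L) = T.Δ g + c • T.Δ (T.t i) + w := by
  have hsmul (c : T.C) {x : L} (hx : x ∈ A) : c • x ∈ A := A.smul_mem hx (c : F₀)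
  obtain ⟨hrA, e, heF, heA, he⟩ := hφ (T.diffGen i hi) ht
  obtain ⟨hsA, g, hgF, hgA, hg⟩ := hφ f hf
  set c : T.C := l (φ f) / l (φ (T.diffGen i hi)) with hc
  refine ⟨g - c • e, sub_mem hgF (Submodule.smul_mem _ c heF), sub_mem hgA (hsmul c heA), c,
    φ f - c • φ (T.diffGen i hi), ⟨⟨f - c • T.diffGen i hi, ?_⟩, ?_⟩,
    sub_mem hsA (hsmul c hrA), ?_⟩
  · rw [map_sub, map_smul]
  · rw [SetLike.mem_coe, LinearMap.mem_ker, map_sub, map_smul, smul_eq_mul, hc,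
      div_mul_cancel₀ _ hl, sub_self]
  · rw [map_sub, map_smul, hg, he, smul_sub, AddSubgroupClass.coe_sub, Submodule.coe_smul]
    change _ = _ - (c • T.Δ (T.t i) - _) + _ + _
    abel

lemma eq_zero_of_Δ_add_smul_eq (hφ : IsCompleteReduction (summableSpace T.Δ (T.fieldSpace i)) φ)
    (hl : l (φ (T.diffGen i hi)) ≠ 0) {f w : T.fieldSpace i} {c : T.C}
    (hw : w ∈ LinearMap.range φ ⊓ LinearMap.ker l)
    (h : T.Δ f + c • T.Δ (T.t i) = w) : c = 0 ∧ T.Δ f = 0 := by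
  obtain ⟨⟨z, rfl⟩, hlw : l (φ z) = 0⟩ := hw
  have hsum : (⟨T.Δ f, T.Δ_mem_fieldSpace hi.le f.2⟩ : T.fieldSpace i) ∈
      summableSpace T.Δ (T.fieldSpace i) := mem_summableSpace.2 ⟨f, f.2, rfl⟩
  have hz : φ z = ⟨T.Δ f, T.Δ_mem_fieldSpace hi.le f.2⟩ + c • T.diffGen i hi :=
    Subtype.ext h.symm
  have hφz : φ z = c • φ (T.diffGen i hi) := by
    conv_lhs => rw [← hφ.apply_apply, hz, map_add, hφ.apply_eq_zero_iff.2 hsum, zero_add, map_smul]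
  have hc : c = 0 := by
    rw [hφz, map_smul, smul_eq_mul] at hlw
    exact (mul_eq_zero.1 hlw).resolve_right hl
  refine ⟨hc, ?_⟩
  rw [hφz, hc, zero_smul, zero_smul, add_zero] at h
  exact h

theorem exists_aeval_eq_Δ_add [CharZero F₀] (hl : l (φ (T.diffGen i hi)) ≠ 0)
    {A : Subalgebra F₀ L} (hσ : ∀ x ∈ A, T.σ x ∈ A) (ht : T.Δ (T.t i) ∈ A)
    (hφ : T.SplitsWithin A φ) {p : (towerField F₀ T.t i)[X]}
    (hp : p ∈ coeffsIn (T.interField A i).toAddSubgroup) :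
    ∃ g ∈ coeffsIn (T.interField A i).toAddSubgroup,
      ∃ r ∈ coeffsIn ((T.interField A i).toAddSubgroup ⊓ T.remainderGroup l φ),
        aeval (T.t i) p = T.Δ (aeval (T.t i) g) + aeval (T.t i) r := by
  have : CharZero (towerField F₀ T.t i) :=
    charZero_of_injective_algebraMap (algebraMap F₀ (towerField F₀ T.t i)).injective
  have hinv (m : ℕ) : (m : towerField F₀ T.t i)⁻¹ ∈ T.interField A i := by
    change (((m : towerField F₀ T.t i)⁻¹ : towerField F₀ T.t i) : L) ∈ A
    simpa using A.algebraMap_mem ((m : F₀)⁻¹)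
  obtain ⟨g, hg, r, hr, hpg⟩ := exists_eq_shiftPoly_sub_self_add (τ := T.σField i hi.le)
    (a := ⟨T.Δ (T.t i), T.diff_mem i hi⟩) (W := T.remainderGroup l φ) (fun x hx => hσ x hx) ht
    hinv (fun f hf => by
      obtain ⟨g, hgF, hgA, c, w, hw, hwA, hfg⟩ :=
        T.exists_eq_Δ_add_smul_add hi hl ht hφ (f := (⟨f, f.2⟩ : T.fieldSpace i)) hf
      rw [smul_eq] at hfg
      exact ⟨⟨g, hgF⟩, hgA, algebraMap F₀ _ (c : F₀), A.algebraMap_mem _, ⟨w, w.2⟩,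
        ⟨hwA, w, hw, rfl⟩, Subtype.ext (T.σ_coe_C c), Subtype.ext hfg⟩) hp
  refine ⟨g, hg, r, hr, ?_⟩
  rw [hpg, map_add, map_sub, (T.isSigmaMonomial i hi).aeval_shiftPoly, Δ_apply]

theorem Δ_aeval_eq_zero [CharZero F₀]
    (hφ : IsCompleteReduction (summableSpace T.Δ (T.fieldSpace i)) φ)
    (hl : l (φ (T.diffGen i hi)) ≠ 0) {g r : (towerField F₀ T.t i)[X]}
    (hr : r ∈ coeffsIn (T.remainderGroup l φ))
    (hgr : T.Δ (aeval (T.t i) g) = aeval (T.t i) r) : T.Δ (aeval (T.t i) g) = 0 := by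
  have : CharZero (towerField F₀ T.t i) :=
    charZero_of_injective_algebraMap (algebraMap F₀ (towerField F₀ T.t i)).injective
  have ht := T.isSigmaMonomial i hi
  have hgr' : T.polyShift i hi g - g = r := ht.aeval_injective (by
    rw [map_sub, ht.aeval_shiftPoly, ← hgr, Δ_apply])
  have hconst : T.polyShift i hi g = g :=
    shiftPoly_eq_self_of_sub_self_mem_coeffsIn (W := T.remainderGroup l φ) (fun f m hm hW => by
      obtain ⟨c, hc⟩ := T.exists_C_of_σ_eq (congrArg Subtype.val hm)
      obtain ⟨w, hw, hfw⟩ := hW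
      obtain ⟨hc0, hf⟩ := T.eq_zero_of_Δ_add_smul_eq hi hφ hl hw (f := ⟨f, f.2⟩) (c := c) (by
        rw [smul_eq, hc]
        exact hfw.symm)
      rw [hc0] at hc
      exact ⟨Subtype.ext (hc.symm.trans (map_zero _)), Subtype.ext (sub_eq_zero.1 hf)⟩)
    (hgr' ▸ hr)
  rw [Δ_apply, ← ht.aeval_shiftPoly, hconst, sub_self]

end Step

variable {i : ℕ} {S : Set L}

/-- The polynomials over `F_i` whose values at `t_{i+1}` lie in `S`; since `t_{i+1}` is
transcendental, this is `S` itself regarded as a set of polynomials. -/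
def polySet (i : ℕ) (S : Set L) : Set (towerField F₀ T.t i)[X] :=
  aeval (T.t i) ⁻¹' S

section Representatives

variable (hi : i < n) (hS : T.IsRepresentatives i S)
include hS

lemma polyShift_zpow_eq_self_of_mem_polySet {p : (towerField F₀ T.t i)[X]} (hp : p ∈ T.polySet i S)
    (m : ℤ) (hm : (T.polyShift i hi ^ m) p ∈ T.polySet i S) : (T.polyShift i hi ^ m) p = p := by
  have ht := T.isSigmaMonomial i hi
  obtain ⟨q, -, hq⟩ := hS.2 _ (hS.1 hp)
  have hp_eq := hq _ ⟨hp, 1, one_mem (towerField F₀ T.t i), one_ne_zero, 0, by simp⟩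
  have hpm_eq := hq _ ⟨hm, 1, one_mem (towerField F₀ T.t i), one_ne_zero, m, by
    rw [one_mul, ht.aeval_shiftPoly_zpow]⟩
  exact ht.aeval_injective (hpm_eq.trans hp_eq.symm)

lemma exists_polyShift_zpow_mem_polySet {q : (towerField F₀ T.t i)[X]} (hqm : q.Monic)
    (hqi : Irreducible q) : ∃ m : ℤ, (T.polyShift i hi ^ m) q ∈ T.polySet i S := by
  have ht := T.isSigmaMonomial i hi
  obtain ⟨p, ⟨hpS, c, hc, -, m, hpq⟩, -⟩ := hS.2 (aeval (T.t i) q) ⟨q, hqm, hqi, rfl⟩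
  obtain ⟨P, hPm, -, rfl⟩ := hS.1 hpS
  have hP : P = Polynomial.C (⟨c, hc⟩ : towerField F₀ T.t i) * (T.polyShift i hi ^ m) q :=
    ht.aeval_injective (by
      rw [map_mul, aeval_C, ht.aeval_shiftPoly_zpow]
      exact hpq)
  have hc1 : (⟨c, hc⟩ : towerField F₀ T.t i) = 1 := by
    have hlead := congrArg leadingCoeff hP
    rwa [hPm.leadingCoeff, leadingCoeff_mul, leadingCoeff_C,
      ((monic_shiftPoly_zpow_iff _ _ m).2 hqm).leadingCoeff, mul_one, eq_comm] at hlead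
  rw [hc1, map_one, one_mul] at hP
  exact ⟨m, hP ▸ hpS⟩

lemma not_dvd_of_aeval_mem_closure (hi : i < n) {q : (towerField F₀ T.t i)[X]} (hqm : q.Monic)
    (hqi : Irreducible q) (hq : q ∉ T.polySet i S) {b : (towerField F₀ T.t i)[X]}
    (hb : aeval (T.t i) b ∈ Submonoid.closure S) : ¬ q ∣ b := by
  suffices ∀ x ∈ Submonoid.closure S, ∃ b : (towerField F₀ T.t i)[X],
      aeval (T.t i) b = x ∧ ¬ q ∣ b by
    obtain ⟨b', hb', hqb⟩ := this _ hb
    rwa [(T.isSigmaMonomial i hi).aeval_injective hb'] at hqb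
  intro x hx
  induction hx using Submonoid.closure_induction with
  | mem x hx =>
    obtain ⟨p, hpm, hpi, rfl⟩ := hS.1 hx
    refine ⟨p, rfl, fun hqp => hq ?_⟩
    rw [eq_of_monic_of_associated hqm hpm (hqi.associated_of_dvd hpi hqp)]
    exact hx
  | one => exact ⟨1, map_one _, fun hq1 => hqi.not_isUnit (isUnit_of_dvd_one hq1)⟩
  | mul x y _ _ hx hy =>
    obtain ⟨c, rfl, hc⟩ := hx
    obtain ⟨d, rfl, hd⟩ := hy
    exact ⟨c * d, map_mul _ _ _, fun hqcd => (hqi.prime.dvd_or_dvd hqcd).elim hc hd⟩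

end Representatives

section Step

variable (hi : i < n)
include hi

lemma exists_of_mem_properComplement {x : L} (hx : x ∈ T.properComplement i S) :
    ∃ a b : (towerField F₀ T.t i)[X], a.degree < b.degree ∧
      aeval (T.t i) b ∈ Submonoid.closure S ∧ x = aeval (T.t i) a / aeval (T.t i) b := by
  induction hx using Submodule.span_induction with
  | mem _ hx => exact hx
  | zero => exact ⟨0, 1, by simp, by rw [map_one]; exact one_mem _, by simp⟩
  | add x y _ _ hx hy =>
    obtain ⟨a, b, hab, hb, rfl⟩ := hx
    obtain ⟨c, d, hcd, hd, rfl⟩ := hy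
    have hb0 := ne_zero_of_degree_gt hab
    have hd0 := ne_zero_of_degree_gt hcd
    refine ⟨a * d + b * c, b * d, ?_, by rw [map_mul]; exact mul_mem hb hd, ?_⟩
    · refine (degree_add_le _ _).trans_lt (max_lt ?_ ?_)
      · rw [degree_mul, degree_mul]
        exact WithBot.add_lt_add_right (degree_ne_bot.2 hd0) hab
      · rw [degree_mul, degree_mul]
        exact WithBot.add_lt_add_left (degree_ne_bot.2 hb0) hcd
    · rw [div_add_div _ _ (aeval_ne_zero_of_transcendental (T.transcendental i hi) hb0)
        (aeval_ne_zero_of_transcendental (T.transcendental i hi) hd0), map_add, map_mul, map_mul,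
        map_mul]
  | smul c x _ hx =>
    obtain ⟨a, b, hab, hb, rfl⟩ := hx
    refine ⟨algebraMap F₀ (towerField F₀ T.t i) c • a, b, (degree_smul_le _ _).trans_lt hab, hb, ?_⟩
    rw [smul_eq, map_smul, Algebra.smul_def, mul_div_assoc]
    rfl

lemma properComplement_le : T.properComplement i S ≤ T.fieldSpace (i + 1) := by
  intro x hx
  obtain ⟨a, b, -, -, rfl⟩ := T.exists_of_mem_properComplement hi hx
  exact div_mem (S := IntermediateField F₀ L) (T.aeval_mem_towerField_succ a)
    (T.aeval_mem_towerField_succ b)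

lemma σ_zpow_mem_map_Δ_sup_iff (U : Submodule T.C L) (m : ℤ) {x : L}
    (hx : x ∈ T.fieldSpace (i + 1)) :
    (T.σ ^ m) x ∈ (T.fieldSpace (i + 1)).map T.Δ ⊔ U ↔
      x ∈ (T.fieldSpace (i + 1)).map T.Δ ⊔ U := by
  have hF (y : L) : T.σ y ∈ T.fieldSpace (i + 1) ↔ y ∈ T.fieldSpace (i + 1) :=
    ⟨fun hy => T.σ.symm_apply_apply y ▸ T.σ_symm_mem_towerField hi hy, T.σ_mem_towerField hi⟩
  have hW (y : L) (hy : y ∈ T.fieldSpace (i + 1)) :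
      T.σ y ∈ (T.fieldSpace (i + 1)).map T.Δ ⊔ U ↔ y ∈ (T.fieldSpace (i + 1)).map T.Δ ⊔ U := by
    have hΔ : T.σ y - y ∈ (T.fieldSpace (i + 1)).map T.Δ ⊔ U :=
      Submodule.mem_sup_left ⟨y, hy, rfl⟩
    refine ⟨fun h => ?_, fun h => by simpa using add_mem hΔ h⟩
    simpa using sub_mem h hΔ
  have h := ringAut_zpow_apply_iff T.σ (P := fun y => y ∈ T.fieldSpace (i + 1) ∧
    y ∈ (T.fieldSpace (i + 1)).map T.Δ ⊔ U)
    (fun y => (and_congr_left' (hF y)).trans (and_congr_right (hW y))) m x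
  rwa [and_iff_right hx, and_iff_right ((ringAut_zpow_apply_iff T.σ hF m x).2 hx)] at h

lemma div_mem_map_Δ_sup_properComplement (hS : T.IsRepresentatives i S)
    {q : (towerField F₀ T.t i)[X]} (hqm : q.Monic) (hqi : Irreducible q) (j : ℕ)
    {a : (towerField F₀ T.t i)[X]} (ha : a.degree < (q ^ j).degree) :
    aeval (T.t i) a / aeval (T.t i) (q ^ j) ∈
      (T.fieldSpace (i + 1)).map T.Δ ⊔ T.properComplement i S := by
  have ht := T.isSigmaMonomial i hi
  obtain ⟨m, hm⟩ := T.exists_polyShift_zpow_mem_polySet hi hS hqm hqi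
  rw [← T.σ_zpow_mem_map_Δ_sup_iff hi _ m (div_mem (S := IntermediateField F₀ L)
    (T.aeval_mem_towerField_succ a) (T.aeval_mem_towerField_succ _))]
  refine Submodule.mem_sup_right (Submodule.subset_span
    ⟨(T.polyShift i hi ^ m) a, (T.polyShift i hi ^ m) (q ^ j), ?_, ?_, ?_⟩)
  · rwa [degree_shiftPoly_zpow, degree_shiftPoly_zpow]
  · rw [map_pow, map_pow]
    exact pow_mem (Submonoid.subset_closure (s := S) hm) j
  · rw [map_div₀, ht.aeval_shiftPoly_zpow, ht.aeval_shiftPoly_zpow]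

variable {l : T.fieldSpace i →ₗ[T.C] T.C} {φ : T.fieldSpace i →ₗ[T.C] T.fieldSpace i}
  [CharZero F₀] (hφ : IsCompleteReduction (summableSpace T.Δ (T.fieldSpace i)) φ)
  (hl : l (φ (T.diffGen i hi)) ≠ 0)
include hφ hl

lemma aeval_mem_map_Δ_sup_polyComplement (p : (towerField F₀ T.t i)[X]) :
    aeval (T.t i) p ∈ (T.fieldSpace (i + 1)).map T.Δ ⊔ T.polyComplement i l φ := by
  obtain ⟨g, -, r, hr, hpg⟩ := T.exists_aeval_eq_Δ_add hi hl
    (A := (towerField F₀ T.t i).toSubalgebra) (fun x hx => T.σ_mem_towerField hi.le hx)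
    (T.diff_mem i hi) (splitsWithin_of_isCompleteReduction le_rfl hφ) (p := p)
    (fun k => (p.coeff k).2)
  rw [hpg]
  exact Submodule.add_mem_sup ⟨_, T.aeval_mem_towerField_succ g, rfl⟩
    (T.mem_polyComplement_iff.2 ⟨r, fun k => (hr k).2, rfl⟩)

variable (hS : T.IsRepresentatives i S)
include hS

open scoped Pointwise in
lemma fieldSpace_succ_le_sup :
    T.fieldSpace (i + 1) ≤ (T.fieldSpace (i + 1)).map T.Δ ⊔
      (T.properComplement i S ⊔ T.polyComplement i l φ) := by
  have hspan : T.fieldSpace (i + 1) ≤ Submodule.span T.C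
      ((Set.univ : Set (towerField F₀ T.t i)) • T.canonicalStep i) := by
    rw [Submodule.span_smul_of_span_eq_top Submodule.span_univ, canonicalStep_eq,
      span_partialFractionSet (T.transcendental i hi)]
    exact fun x hx => T.mem_towerField_succ.1 hx
  refine hspan.trans (Submodule.span_le.2 ?_)
  rintro _ ⟨c, -, η, ⟨k, rfl⟩ | ⟨q, k, j, hqm, hqi, hk, hj, rfl⟩, rfl⟩
  · have hle : (T.fieldSpace (i + 1)).map T.Δ ⊔ T.polyComplement i l φ ≤
        (T.fieldSpace (i + 1)).map T.Δ ⊔ (T.properComplement i S ⊔ T.polyComplement i l φ) :=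
      sup_le_sup_left le_sup_right _
    have hmem := hle (T.aeval_mem_map_Δ_sup_polyComplement hi hφ hl (c • X ^ k))
    rwa [map_smul, map_pow, aeval_X] at hmem
  · have hle : (T.fieldSpace (i + 1)).map T.Δ ⊔ T.properComplement i S ≤
        (T.fieldSpace (i + 1)).map T.Δ ⊔ (T.properComplement i S ⊔ T.polyComplement i l φ) :=
      sup_le_sup_left le_sup_left _
    have hdeg : (c • X ^ k : (towerField F₀ T.t i)[X]).degree < (q ^ j).degree := by
      refine (degree_smul_le _ _).trans_lt ?_
      rw [degree_X_pow, degree_eq_natDegree (hqm.pow j).ne_zero, hqm.natDegree_pow, Nat.cast_lt]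
      exact hk.trans_le (Nat.le_mul_of_pos_left _ hj)
    have hmem := hle (T.div_mem_map_Δ_sup_properComplement hi hS hqm hqi j hdeg)
    rwa [map_smul, map_pow, map_pow, aeval_X, smul_div_assoc] at hmem

lemma Δ_eq_zero_of_mem_complement {f : L} (hf : f ∈ T.fieldSpace (i + 1))
    (hΔ : T.Δ f ∈ T.properComplement i S ⊔ T.polyComplement i l φ) : T.Δ f = 0 := by
  have ht := T.isSigmaMonomial i hi
  obtain ⟨u, hu, v, hv, huv⟩ := Submodule.mem_sup.1 hΔ
  obtain ⟨a, b, hab, hb, rfl⟩ := T.exists_of_mem_properComplement hi hu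
  obtain ⟨r, hr, rfl⟩ := T.mem_polyComplement_iff.1 hv
  obtain ⟨c, d, hd, rfl⟩ := T.exists_div_of_mem_towerField_succ hf
  obtain ⟨g, hg⟩ := ht.exists_aeval_eq_of_regularAt_sub (S := T.polySet i S)
    (fun p hp m hm => T.polyShift_zpow_eq_self_of_mem_polySet hi hS hp m hm) hd (c := c)
    (fun q hqm hqi hq => by
      have hreg : RegularAt (T.t i) q (aeval (T.t i) a / aeval (T.t i) b) :=
        ⟨a, b, T.not_dvd_of_aeval_mem_closure hS hi hqm hqi hq hb, rfl⟩
      have hsum := hreg.add ht.transcendental hqi.prime (regularAt_aeval hqi.prime r)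
      rw [huv] at hsum
      exact hsum)
  rw [← hg] at huv ⊢
  have hb0 : b ≠ 0 := ne_zero_of_degree_gt hab
  have hdvd : b ∣ a := by
    refine ⟨T.polyShift i hi g - g - r, ht.aeval_injective ?_⟩
    rw [map_mul, map_sub, map_sub, ht.aeval_shiftPoly, ← Δ_apply, ← huv, add_sub_cancel_right,
      mul_div_cancel₀ _ (aeval_ne_zero_of_transcendental ht.transcendental hb0)]
  have ha0 : a = 0 := eq_zero_of_dvd_of_degree_lt hdvd hab
  rw [ha0, map_zero, zero_div, zero_add] at huv
  exact T.Δ_aeval_eq_zero hi hφ hl hr huv.symm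

theorem isCompl_complement :
    IsCompl (T.complement i S l φ) (summableSpace T.Δ (T.fieldSpace (i + 1))) := by
  constructor
  · rw [Submodule.disjoint_def]
    rintro x (hx : (x : L) ∈ T.properComplement i S ⊔ T.polyComplement i l φ) hΔ
    obtain ⟨g, hg, hgx⟩ := mem_summableSpace.1 hΔ
    rw [← hgx] at hx
    exact Subtype.ext (hgx ▸ T.Δ_eq_zero_of_mem_complement hi hφ hl hS hg hx)
  · rw [codisjoint_iff, Submodule.eq_top_iff']
    intro x
    obtain ⟨_, ⟨g, hg, rfl⟩, y, hy, hgy⟩ :=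
      Submodule.mem_sup.1 (T.fieldSpace_succ_le_sup hi hφ hl hS x.2)
    have hyF : y ∈ T.fieldSpace (i + 1) :=
      sup_le (T.properComplement_le hi) T.polyComplement_le hy
    have hx : x = ⟨y, hyF⟩ + ⟨T.Δ g, T.Δ_mem_fieldSpace hi hg⟩ :=
      Subtype.ext (by rw [← hgy, add_comm]; rfl)
    rw [hx]
    exact Submodule.add_mem_sup hy (mem_summableSpace.2 ⟨g, hg, rfl⟩)

end Step

end SigmaTower

/-! ### Complete reductions of a tower -/

section CompleteReduction

variable {C : Type u} {V : Type v} {V' : Type w} [Field C] [AddCommGroup V] [Module C V]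
  [AddCommGroup V'] [Module C V']

lemma IsCompleteReduction.conj {U : Submodule C V} {φ : V →ₗ[C] V} (h : IsCompleteReduction U φ)
    (e : V ≃ₗ[C] V') : IsCompleteReduction (U.map (e : V →ₗ[C] V')) (e.conj φ) := by
  constructor
  · intro f
    refine ⟨_, h.sub_mem (e.symm f), ?_⟩
    rw [LinearEquiv.coe_coe, map_sub, LinearEquiv.apply_symm_apply, LinearEquiv.conj_apply_apply]
  · ext f
    rw [LinearMap.mem_ker, LinearEquiv.conj_apply_apply, LinearEquiv.map_eq_zero_iff,
      h.apply_eq_zero_iff, Submodule.mem_map_equiv]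

lemma isCompleteReduction_projection {U W : Submodule C V} (h : IsCompl U W) :
    IsCompleteReduction W (U.projection W h) :=
  ⟨fun f => Submodule.sub_projection_mem h f, Submodule.ker_projection h⟩

end CompleteReduction

namespace SigmaTower

variable {F₀ : Type u} {L : Type v} [Field F₀] [Field L] [Algebra F₀ L] {n : ℕ}
  (T : SigmaTower F₀ L n)

section ReductionStep

variable {i : ℕ} {S : Set L} {l : T.fieldSpace i →ₗ[T.C] T.C}
  {φ : T.fieldSpace i →ₗ[T.C] T.fieldSpace i}
  (h : IsCompl (T.complement i S l φ) (summableSpace T.Δ (T.fieldSpace (i + 1))))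
include h

lemma isCompleteReduction_reductionStep :
    IsCompleteReduction (summableSpace T.Δ (T.fieldSpace (i + 1))) (T.reductionStep i S l φ) := by
  rw [reductionStep, dif_pos h]
  exact isCompleteReduction_projection h

lemma reductionStep_eq {f r : T.fieldSpace (i + 1)} (hr : r ∈ T.complement i S l φ)
    (hfr : f - r ∈ summableSpace T.Δ (T.fieldSpace (i + 1))) :
    T.reductionStep i S l φ f = r := by
  rw [reductionStep, dif_pos h, ← add_sub_cancel r f, map_add,
    Submodule.projection_apply_of_mem_left h hr,
    (Submodule.projection_apply_eq_zero_iff h).2 hfr, add_zero]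

lemma coe_reductionStep_eq_aeval {f : T.fieldSpace (i + 1)} {g : L} (hg : g ∈ T.fieldSpace (i + 1))
    {r : (towerField F₀ T.t i)[X]} (hr : r ∈ coeffsIn (T.remainderGroup l φ))
    (hf : (f : L) = T.Δ g + aeval (T.t i) r) :
    (T.reductionStep i S l φ f : L) = aeval (T.t i) r := by
  rw [T.reductionStep_eq h (r := ⟨aeval (T.t i) r, T.aeval_mem_towerField_succ r⟩)]
  · have hmem : aeval (T.t i) r ∈ T.polyComplement i l φ := T.mem_polyComplement_iff.2 ⟨r, hr, rfl⟩
    exact Submodule.mem_sup_right (S := T.properComplement i S) hmem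
  · exact mem_summableSpace.2 ⟨g, hg, (sub_eq_of_eq_add hf).symm⟩

end ReductionStep

lemma map_baseEquiv_range_groundDiff :
    (LinearMap.range (groundDiff T.σ₀)).map (T.baseEquiv : F₀ →ₗ[T.C] T.fieldSpace 0) =
      summableSpace T.Δ (T.fieldSpace 0) := by
  have hΔ (a : F₀) : T.Δ (T.baseEquiv a : L) = (T.baseEquiv (groundDiff T.σ₀ a) : L) := by
    change T.σ (algebraMap F₀ L a) - algebraMap F₀ L a = algebraMap F₀ L (T.σ₀ a - a)
    rw [T.σ_algebraMap, map_sub]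
  ext f
  rw [mem_summableSpace]
  constructor
  · rintro ⟨_, ⟨a, rfl⟩, rfl⟩
    exact ⟨T.baseEquiv a, (T.baseEquiv a).2, hΔ a⟩
  · rintro ⟨g, hg, hgf⟩
    obtain ⟨a, ha⟩ := T.baseEquiv.surjective ⟨g, hg⟩
    refine ⟨groundDiff T.σ₀ a, ⟨a, rfl⟩, Subtype.ext ?_⟩
    rw [LinearEquiv.coe_coe, ← hΔ, ha, hgf]

lemma diffGen_notMem_summableSpace {i : ℕ} (hi : i < n) :
    T.diffGen i hi ∉ summableSpace T.Δ (T.fieldSpace i) := by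
  intro hmem
  obtain ⟨g, hg, hgt : T.Δ g = T.Δ (T.t i)⟩ := mem_summableSpace.1 hmem
  rw [Δ_apply, Δ_apply] at hgt
  obtain ⟨c, hc⟩ := T.const_eq (T.t i - g) (by rw [map_sub]; linear_combination -hgt)
  have ht : T.t i ∈ towerField F₀ T.t i := by
    rw [← sub_add_cancel (T.t i) g, ← hc]
    exact add_mem (IntermediateField.algebraMap_mem _ c) hg
  exact T.transcendental i hi (isAlgebraic_algebraMap (⟨T.t i, ht⟩ : towerField F₀ T.t i))

section Reduction

variable {ι : Type w} {b : Module.Basis ι T.C F₀} {φ₀ : F₀ →ₗ[T.C] F₀} {S : ℕ → Set L}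
  {θ : (i : ℕ) → T.fieldSpace i}

lemma reduction_congr (Θ₀ : Set F₀) {θ' : (i : ℕ) → T.fieldSpace i} {i : ℕ}
    (h : ∀ j < i, θ j = θ' j) : T.reduction Θ₀ φ₀ S θ i = T.reduction Θ₀ φ₀ S θ' i := by
  induction i with
  | zero => rfl
  | succ i ih =>
    rw [reduction, reduction, ih fun j hj => h j (Nat.lt_succ_of_lt hj), h i (Nat.lt_succ_self i)]

variable (φ₀ S θ) in
/-- The condition that `IsSecondPairs` imposes on `θ_{i+1}`; it only involves `θ_1, …, θ_{i+1}`, so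
that these elements can be chosen one after the other. -/
def IsSecondPairAt (Θ₀ : Set F₀) (i : ℕ) (hi : i < n) : Prop :=
  (θ i : L) ∈ T.canonicalBasis Θ₀ i ∧
    T.canonicalCoord Θ₀ i (θ i) (T.reduction Θ₀ φ₀ S θ i (T.diffGen i hi)) ≠ 0 ∧
    T.indicator (θ i) = T.indicator (T.reduction Θ₀ φ₀ S θ i (T.diffGen i hi))

variable [CharZero F₀] (hφ₀ : IsCompleteReduction (LinearMap.range (groundDiff T.σ₀)) φ₀)
  (hS : ∀ i < n, T.IsRepresentatives i (S i))
include hφ₀ hS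

lemma isCompleteReduction_reduction {i : ℕ} (hi : i ≤ n)
    (hθ : ∀ (j : ℕ) (hj : j < n), j < i → T.IsSecondPairAt φ₀ S θ (Set.range b) j hj) :
    IsCompleteReduction (summableSpace T.Δ (T.fieldSpace i))
      (T.reduction (Set.range b) φ₀ S θ i) := by
  induction i with
  | zero =>
    rw [← map_baseEquiv_range_groundDiff]
    exact hφ₀.conj T.baseEquiv
  | succ i ih =>
    have hred := ih (Nat.le_of_succ_le hi) fun j hj hji => hθ j hj (Nat.lt_succ_of_lt hji)
    exact T.isCompleteReduction_reductionStep
      (T.isCompl_complement hi hred (hθ i hi (Nat.lt_succ_self i)).2.1 (hS i hi))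

lemma exists_isSecondPairs :
    ∃ θ : (i : ℕ) → T.fieldSpace i, T.IsSecondPairs (Set.range b) φ₀ S θ := by
  suffices ∀ k ≤ n, ∃ θ : (i : ℕ) → T.fieldSpace i, ∀ (j : ℕ) (hj : j < n), j < k →
      T.IsSecondPairAt φ₀ S θ (Set.range b) j hj by
    obtain ⟨θ, hθ⟩ := this n le_rfl
    exact ⟨θ, fun j hj => hθ j hj hj⟩
  intro k hk
  induction k with
  | zero => exact ⟨fun _ => 0, fun j _ hj => absurd hj (Nat.not_lt_zero j)⟩
  | succ k ih =>
    obtain ⟨θ, hθ⟩ := ih (Nat.le_of_succ_le hk)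
    have hred := T.isCompleteReduction_reduction hφ₀ hS (Nat.le_of_succ_le hk) hθ
    obtain ⟨ξ, hξ⟩ := T.exists_canonicalCoord_ne_zero b (Nat.le_of_succ_le hk)
      (f := T.reduction (Set.range b) φ₀ S θ k (T.diffGen k hk))
      (fun h0 => T.diffGen_notMem_summableSpace hk (hred.apply_eq_zero_iff.1 h0))
    have hcongr (j : ℕ) (hj : j ≤ k) : T.reduction (Set.range b) φ₀ S (Function.update θ k ξ) j =
        T.reduction (Set.range b) φ₀ S θ j :=
      T.reduction_congr _ fun m hm => Function.update_of_ne (by omega) _ _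
    refine ⟨Function.update θ k ξ, fun j hj hjk => ?_⟩
    rw [IsSecondPairAt, hcongr j (Nat.le_of_lt_succ hjk)]
    rcases Nat.lt_succ_iff_lt_or_eq.1 hjk with hlt | rfl
    · rw [Function.update_of_ne hlt.ne]
      exact hθ j hj hlt
    · rw [Function.update_self]
      exact hξ

variable (hθ : T.IsSecondPairs (Set.range b) φ₀ S θ)
include hθ

lemma isCompl_complement_reduction {i : ℕ} (hi : i < n) :
    IsCompl (T.complement i (S i) (T.canonicalCoord (Set.range b) i (θ i))
      (T.reduction (Set.range b) φ₀ S θ i)) (summableSpace T.Δ (T.fieldSpace (i + 1))) :=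
  T.isCompl_complement hi
    (T.isCompleteReduction_reduction hφ₀ hS hi.le fun j hj _ => hθ j hj) (hθ i hi).2.1 (hS i hi)

variable (hT : T.IsRingTower)
include hT

lemma splitsWithin_reduction {i : ℕ} (hi : i ≤ n) :
    T.SplitsWithin (towerRing F₀ T.t i) (T.reduction (Set.range b) φ₀ S θ i) := by
  induction i with
  | zero =>
    refine splitsWithin_of_isCompleteReduction (fun x hx => ?_)
      (T.isCompleteReduction_reduction hφ₀ hS hi fun j hj _ => hθ j hj)
    obtain ⟨a, rfl⟩ := (T.mem_fieldSpace_zero x).1 hx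
    exact Subalgebra.algebraMap_mem _ a
  | succ i ih =>
    intro f hf
    obtain ⟨p, hp, hpf⟩ := T.mem_towerRing_succ.1 hf
    obtain ⟨g, hg, r, hr, hgr⟩ := T.exists_aeval_eq_Δ_add hi (hθ i hi).2.1
      (fun x hx => T.σ_mem_towerRing hT (Nat.le_of_succ_le hi) hx) (hT i hi)
      (ih (Nat.le_of_succ_le hi)) hp
    rw [hpf] at hgr
    have hred : (T.reduction (Set.range b) φ₀ S θ (i + 1) f : L) = aeval (T.t i) r :=
      T.coe_reductionStep_eq_aeval (T.isCompl_complement_reduction hφ₀ hS hθ hi)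
        (T.aeval_mem_towerField_succ g) (fun k => (hr k).2) hgr
    rw [hred]
    exact ⟨T.mem_towerRing_succ.2 ⟨r, fun k => (hr k).1, rfl⟩, aeval (T.t i) g,
      T.aeval_mem_towerField_succ g, T.mem_towerRing_succ.2 ⟨g, hg, rfl⟩,
      eq_sub_of_add_eq hgr.symm⟩

lemma exists_isCompleteReduction_ringSpace {i : ℕ} (hi : i ≤ n) :
    ∃ ψ : T.ringSpace i →ₗ[T.C] T.ringSpace i,
      (∀ f : T.ringSpace i, (ψ f : L) = T.reduction (Set.range b) φ₀ S θ i
        (Submodule.inclusion (T.ringSpace_le_fieldSpace i) f)) ∧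
      IsCompleteReduction
        (LinearMap.range (T.Δ.restrict fun _ hf => T.Δ_mem_ringSpace hT hi hf)) ψ := by
  have hred := T.isCompleteReduction_reduction hφ₀ hS hi fun j hj _ => hθ j hj
  set φ := T.reduction (Set.range b) φ₀ S θ i
  have hsplit (f : T.ringSpace i) := T.splitsWithin_reduction hφ₀ hS hθ hT hi
    (Submodule.inclusion (T.ringSpace_le_fieldSpace i) f) f.2
  let ψ : T.ringSpace i →ₗ[T.C] T.ringSpace i := LinearMap.codRestrict (T.ringSpace i)
    ((T.fieldSpace i).subtype ∘ₗ φ ∘ₗ Submodule.inclusion (T.ringSpace_le_fieldSpace i))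
    fun f => (hsplit f).1
  have hψ (f : T.ringSpace i) :
      (ψ f : L) = φ (Submodule.inclusion (T.ringSpace_le_fieldSpace i) f) := rfl
  have hsub (f : T.ringSpace i) : f - ψ f ∈
      LinearMap.range (T.Δ.restrict fun _ hf => T.Δ_mem_ringSpace hT hi hf) := by
    obtain ⟨-, g, -, hg, hgf⟩ := hsplit f
    exact ⟨⟨g, hg⟩, Subtype.ext hgf⟩
  refine ⟨ψ, hψ, hsub, Submodule.ext fun f => ?_⟩
  rw [LinearMap.mem_ker]
  constructor
  · intro hf
    simpa only [hf, sub_zero] using hsub f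
  · rintro ⟨g, rfl⟩
    have hmem : Submodule.inclusion (T.ringSpace_le_fieldSpace i)
        (T.Δ.restrict (fun _ hf => T.Δ_mem_ringSpace hT hi hf) g) ∈
          summableSpace T.Δ (T.fieldSpace i) :=
      mem_summableSpace.2 ⟨g, T.ringSpace_le_fieldSpace i g.2, rfl⟩
    exact Subtype.ext ((hψ _).trans (congrArg Subtype.val (hred.apply_eq_zero_iff.2 hmem)))

end Reduction

end SigmaTower

/-! ### Computability -/

section Computability

variable {α β γ : Type*} [Primcodable α] [Primcodable β] [Primcodable γ]

lemma computable_list_foldl {f : α → List β} {g : α → γ} {h : α → γ × β → γ}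
    (hf : Computable f) (hg : Computable g) (hh : Computable₂ h) :
    Computable fun a => (f a).foldl (fun s b => h a (s, b)) (g a) := by
  have hstep : Computable₂ fun (a : α) (p : ℕ × γ) =>
      (Option.casesOn ((f a)[p.1]?) p.2 fun b => h a (p.2, b) : γ) :=
    Computable.option_casesOn (o := fun p : α × ℕ × γ => (f p.1)[p.2.1]?) (f := fun p => p.2.2)
      (g := fun p b => h p.1 (p.2.2, b))
      (Computable.list_getElem?.comp (hf.comp Computable.fst) (Computable.fst.comp Computable.snd))
      (Computable.snd.comp Computable.snd)
      (hh.comp (Computable.fst.comp Computable.fst)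
        ((Computable.snd.comp (Computable.snd.comp Computable.fst)).pair Computable.snd))
  have htake (a : α) (k : ℕ) : Nat.rec (motive := fun _ => γ) (g a)
      (fun k s => Option.casesOn ((f a)[k]?) s fun b => h a (s, b)) k =
        ((f a).take k).foldl (fun s b => h a (s, b)) (g a) := by
    induction k with
    | zero => rfl
    | succ k ih =>
      simp only [ih, List.take_add_one, List.foldl_append]
      cases (f a)[k]? <;> rfl
  exact (Computable.nat_rec (Computable.list_length.comp hf) hg hstep).of_eq fun a =>
    (htake a _).trans (by rw [List.take_length])

lemma computable_list_foldr {f : α → List β} {g : α → γ} {h : α → β × γ → γ}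
    (hf : Computable f) (hg : Computable g) (hh : Computable₂ h) :
    Computable fun a => (f a).foldr (fun b s => h a (b, s)) (g a) :=
  (computable_list_foldl (h := fun a p => h a p.swap) (Computable.list_reverse.comp hf) hg
    (hh.comp Computable.fst ((Computable.snd.comp Computable.snd).pair
      (Computable.fst.comp Computable.snd)))).of_eq fun _ => List.foldl_reverse

lemma computable_list_map {f : α → List β} {g : α → β → γ} (hf : Computable f)
    (hg : Computable₂ g) : Computable fun a => (f a).map (g a) :=
  (computable_list_foldr (h := fun a p => g a p.1 :: p.2) hf (Computable.const [])
    (Computable.list_cons.comp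
      (hg.comp Computable.fst (Computable.fst.comp Computable.snd))
      (Computable.snd.comp Computable.snd))).of_eq fun _ => List.map_eq_foldr.symm

lemma computable_and {f g : α → Bool} (hf : Computable f) (hg : Computable g) :
    Computable fun a => f a && g a :=
  Primrec.and.to_comp.comp hf hg

lemma computable_list_all {f : β → Bool} (hf : Computable f) :
    Computable fun l : List β => l.all f :=
  (computable_list_foldr (f := id) (h := fun _ p => f p.1 && p.2) Computable.id
    (Computable.const true) (computable_and (hf.comp (Computable.fst.comp Computable.snd))
      (Computable.snd.comp Computable.snd))).of_eq fun l => by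
        induction l with
        | nil => rfl
        | cons b l ih => exact congrArg (f b && ·) ih

lemma computable_list_getD (z : β) : Computable₂ fun (l : List β) (k : ℕ) => l.getD k z :=
  (Computable.option_getD Computable.list_getElem? (Computable.const z)).of_eq fun _ =>
    List.getD_eq_getElem?_getD.symm

lemma exists_computable_of_forall_exists {P : α → β → Bool} (hP : Computable₂ P)
    (h : ∀ a, ∃ b, P a b = true) : ∃ f : α → β, Computable f ∧ ∀ a, P a (f a) = true := by
  let F : α → ℕ → Option β := fun a k =>
    (Encodable.decode k : Option β).bind fun b => cond (P a b) (some b) none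
  have hF : Computable₂ F :=
    Computable.option_bind (f := fun p : α × ℕ => (Encodable.decode p.2 : Option β))
      (g := fun p b => cond (P p.1 b) (some b) none) (Computable.decode.comp Computable.snd)
      (Computable.cond (hP.comp (Computable.fst.comp Computable.fst) Computable.snd)
        (Computable.option_some.comp Computable.snd) (Computable.const none))
  have hdom (a : α) : (Nat.rfindOpt (F a)).Dom := by
    obtain ⟨b, hb⟩ := h a
    exact Nat.rfindOpt_dom.2 ⟨Encodable.encode b, b, by simp [F, hb]⟩
  refine ⟨fun a => (Nat.rfindOpt (F a)).get (hdom a),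
    (Partrec.rfindOpt hF).of_eq_tot fun a => Part.get_mem _, fun a => ?_⟩
  obtain ⟨k, hk⟩ := Nat.rfindOpt_spec (Part.get_mem (hdom a))
  obtain ⟨b, -, hb⟩ := Option.bind_eq_some_iff.1 (Option.mem_def.1 hk)
  cases hPb : P a b with
  | false => simp [hPb] at hb
  | true =>
    rw [hPb] at hb
    obtain rfl := Option.some.inj hb
    exact hPb

lemma exists_computable_isZero (F : Type*) [Zero F] [Primcodable F] :
    ∃ f : F → Bool, Computable f ∧ ∀ a, f a = true ↔ a = 0 := by
  classical
  exact ⟨fun a => decide (a = 0), (Primrec.eq.decide.comp Primrec.id (Primrec.const 0)).to_comp,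
    fun a => decide_eq_true_iff⟩

end Computability

section ListPoly

variable {R β : Type*} [CommRing R] {ev : β → R}

/-- The polynomial whose coefficients, in ascending order, are coded by the list `l`; several lists
code the same polynomial because trailing codes of zero are allowed. -/
def listPoly (ev : β → R) (l : List β) : R[X] :=
  l.foldr (fun c p => C (ev c) + X * p) 0

@[simp]
lemma listPoly_nil : listPoly ev [] = 0 := rfl

@[simp]
lemma listPoly_cons (c : β) (l : List β) :
    listPoly ev (c :: l) = C (ev c) + X * listPoly ev l := rfl

lemma coeff_listPoly (l : List β) (k : ℕ) : (listPoly ev l).coeff k = (l[k]?).elim 0 ev := by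
  induction l generalizing k with
  | nil => simp
  | cons c l ih => cases k <;> simp [ih, coeff_C_succ]

lemma coeff_listPoly_eq_getD {z : β} (hz : ev z = 0) (l : List β) (k : ℕ) :
    (listPoly ev l).coeff k = ev (l.getD k z) := by
  rw [coeff_listPoly, List.getD_eq_getElem?_getD]
  cases l[k]?
  · exact hz.symm
  · rfl

lemma coeff_listPoly_map_range (N : ℕ) (g : ℕ → β) (k : ℕ) :
    (listPoly ev ((List.range N).map g)).coeff k = if k < N then ev (g k) else 0 := by
  rw [coeff_listPoly, List.getElem?_map]
  split_ifs with hk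
  · rw [List.getElem?_range hk]
    rfl
  · rw [List.getElem?_eq_none (by simpa using hk)]
    rfl

lemma listPoly_mem_coeffsIn_iff {A : AddSubgroup R} {l : List β} :
    listPoly ev l ∈ coeffsIn A ↔ ∀ c ∈ l, ev c ∈ A := by
  constructor
  · intro h c hc
    obtain ⟨k, hk⟩ := List.getElem?_of_mem hc
    have hmem := h k
    rwa [coeff_listPoly, hk] at hmem
  · intro h k
    rw [coeff_listPoly]
    cases hk : l[k]? with
    | none => exact A.zero_mem
    | some c => exact h c (List.mem_of_getElem? hk)

lemma listPoly_eq_zero_iff {l : List β} : listPoly ev l = 0 ↔ ∀ c ∈ l, ev c = 0 :=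
  Polynomial.ext_iff.trans (listPoly_mem_coeffsIn_iff (A := ⊥))

lemma listPoly_map {f : β → β} {e : R} (hf : ∀ a, ev (f a) = e * ev a) (l : List β) :
    listPoly ev (l.map f) = C e * listPoly ev l := by
  ext k
  rw [coeff_C_mul, coeff_listPoly, coeff_listPoly, List.getElem?_map]
  cases l[k]? <;> simp [hf]

lemma exists_listPoly_eq {p : R[X]} (hp : ∀ k, ∃ c, ev c = p.coeff k) :
    ∃ l, listPoly ev l = p := by
  choose g hg using hp
  refine ⟨(List.range (p.natDegree + 1)).map g, Polynomial.ext fun k => ?_⟩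
  rw [coeff_listPoly_map_range, hg, ite_eq_left_iff, Nat.lt_succ_iff, not_le]
  exact fun hk => (coeff_eq_zero_of_natDegree_lt hk).symm

end ListPoly

/-- The coding `ev` of certain elements of `R` makes addition, multiplication by a fixed element,
the automorphism `σ` and the zero test computable. Distinct codes may code the same element. -/
structure IsComputableCoding {R β : Type*} [CommRing R] [Primcodable β] (σ : R ≃+* R)
    (ev : β → R) : Prop where
  zero : ∃ z, ev z = 0
  add : ∃ f : β → β → β, Computable₂ f ∧ ∀ a b, ev (f a b) = ev a + ev b
  neg : ∃ f : β → β, Computable f ∧ ∀ a, ev (f a) = -ev a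
  mul : ∀ e : β, ∃ f : β → β, Computable f ∧ ∀ a, ev (f a) = ev e * ev a
  shift : ∃ f : β → β, Computable f ∧ ∀ a, ev (f a) = σ (ev a)
  isZero : ∃ f : β → Bool, Computable f ∧ ∀ a, f a = true ↔ ev a = 0

namespace IsComputableCoding

variable {R β : Type*} [CommRing R] [Primcodable β] {σ : R ≃+* R} {ev : β → R}

lemma map_iff {R' : Type*} [CommRing R'] {σ' : R' ≃+* R'} {f : R →+* R'}
    (hf : Function.Injective f) (hfσ : ∀ x, f (σ x) = σ' (f x)) :
    IsComputableCoding σ' (fun c => f (ev c)) ↔ IsComputableCoding σ ev := by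
  constructor
  · rintro ⟨zero, add, neg, mul, shift, isZero⟩
    simp only [← hfσ, ← map_add, ← map_neg, ← map_mul, hf.eq_iff, map_eq_zero_iff f hf]
      at zero add neg mul shift isZero
    exact ⟨zero, add, neg, mul, shift, isZero⟩
  · rintro ⟨zero, add, neg, mul, shift, isZero⟩
    constructor <;>
      simpa only [← hfσ, ← map_add, ← map_neg, ← map_mul, hf.eq_iff, map_eq_zero_iff f hf]

variable (h : IsComputableCoding σ ev)
include h

lemma exists_computable_listPoly_add : ∃ f : List β → List β → List β, Computable₂ f ∧
    ∀ l m, listPoly ev (f l m) = listPoly ev l + listPoly ev m := by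
  obtain ⟨z, hz⟩ := h.zero
  obtain ⟨add, hadd, hadd'⟩ := h.add
  refine ⟨fun l m => (List.range (l.length + m.length)).map fun k =>
    add (l.getD k z) (m.getD k z), ?_, fun l m => Polynomial.ext fun k => ?_⟩
  · exact computable_list_map (f := fun p : List β × List β =>
        List.range (p.1.length + p.2.length))
      (g := fun p k => add (p.1.getD k z) (p.2.getD k z))
      (Primrec.list_range.to_comp.comp (Primrec.nat_add.to_comp.comp
        (Computable.list_length.comp Computable.fst) (Computable.list_length.comp Computable.snd)))
      (hadd.comp
        ((computable_list_getD z).comp (Computable.fst.comp Computable.fst) Computable.snd)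
        ((computable_list_getD z).comp (Computable.snd.comp Computable.fst) Computable.snd))
  · rw [coeff_listPoly_map_range, hadd', coeff_add, coeff_listPoly_eq_getD hz,
      coeff_listPoly_eq_getD hz, ite_eq_left_iff, not_lt]
    intro hk
    rw [List.getD_eq_default _ _ (by omega), List.getD_eq_default _ _ (by omega), hz, add_zero]

lemma exists_computable_listPoly_mul (e : List β) : ∃ f : List β → List β, Computable f ∧
    ∀ l, listPoly ev (f l) = listPoly ev e * listPoly ev l := by
  obtain ⟨z, hz⟩ := h.zero
  obtain ⟨add, hadd, hadd'⟩ := h.exists_computable_listPoly_add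
  induction e with
  | nil => exact ⟨fun _ => [], Computable.const _, fun l => by simp⟩
  | cons c e ih =>
    obtain ⟨f, hf, hf'⟩ := ih
    obtain ⟨m, hm, hm'⟩ := h.mul c
    refine ⟨fun l => add (l.map m) (z :: f l),
      hadd.comp (computable_list_map Computable.id (hm.comp Computable.snd))
        (Computable.list_cons.comp (Computable.const z) hf), fun l => ?_⟩
    rw [hadd', listPoly_map hm', listPoly_cons, listPoly_cons, hz, hf', C_0]
    ring

lemma exists_computable_listPoly_shift (a : β) : ∃ f : List β → List β, Computable f ∧
    ∀ l, listPoly ev (f l) = shiftPoly σ (ev a) (listPoly ev l) := by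
  obtain ⟨s, hs, hs'⟩ := h.shift
  obtain ⟨m, hm, hm'⟩ := h.mul a
  obtain ⟨add, hadd, hadd'⟩ := h.exists_computable_listPoly_add
  refine ⟨fun l => l.foldr (fun c r => add (s c :: r) (r.map m)) [], ?_, fun l => ?_⟩
  · have hrest : Computable fun p : List β × β × List β => p.2.2 :=
      Computable.snd.comp Computable.snd
    exact computable_list_foldr (f := id) (h := fun _ p => add (s p.1 :: p.2) (p.2.map m))
      Computable.id (Computable.const _)
      (hadd.comp
        (Computable.list_cons.comp (hs.comp (Computable.fst.comp Computable.snd)) hrest)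
        (computable_list_map hrest (hm.comp Computable.snd)))
  · induction l with
    | nil => simp
    | cons c l ih =>
      beta_reduce at ih ⊢
      rw [List.foldr_cons, hadd', listPoly_map hm', listPoly_cons, listPoly_cons, ih, hs',
        map_add, map_mul, shiftPoly_C, shiftPoly_X]
      ring

theorem isComputableCoding_listPoly (a : β) :
    IsComputableCoding (shiftPoly σ (ev a)) (listPoly ev) where
  zero := ⟨[], rfl⟩
  add := h.exists_computable_listPoly_add
  neg := by
    obtain ⟨f, hf, hf'⟩ := h.neg
    refine ⟨fun l => l.map f, computable_list_map Computable.id (hf.comp Computable.snd),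
      fun l => ?_⟩
    rw [listPoly_map (e := -1) fun c => by rw [hf', neg_one_mul], C_neg, C_1, neg_one_mul]
  mul := h.exists_computable_listPoly_mul
  shift := h.exists_computable_listPoly_shift a
  isZero := by
    obtain ⟨f, hf, hf'⟩ := h.isZero
    refine ⟨fun l => l.all f, computable_list_all hf, fun l => ?_⟩
    simp only [List.all_eq_true, listPoly_eq_zero_iff, hf']

lemma exists_computable_eq : ∃ f : β → β → Bool, Computable₂ f ∧
    ∀ a b, f a b = true ↔ ev a = ev b := by
  obtain ⟨add, hadd, hadd'⟩ := h.add
  obtain ⟨neg, hneg, hneg'⟩ := h.neg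
  obtain ⟨isZero, hzero, hzero'⟩ := h.isZero
  refine ⟨fun a b => isZero (add a (neg b)),
    hzero.comp (hadd.comp Computable.fst (hneg.comp Computable.snd)), fun a b => ?_⟩
  rw [hzero', hadd', hneg', ← sub_eq_add_neg, sub_eq_zero]

lemma exists_computable_eq_shift_sub_add : ∃ f : β → β × β → Bool, Computable₂ f ∧
    ∀ c p, f c p = true ↔ ev c = σ (ev p.1) - ev p.1 + ev p.2 := by
  obtain ⟨add, hadd, hadd'⟩ := h.add
  obtain ⟨neg, hneg, hneg'⟩ := h.neg
  obtain ⟨shift, hshift, hshift'⟩ := h.shift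
  obtain ⟨eq, heq, heq'⟩ := h.exists_computable_eq
  have hfst : Computable fun x : β × β × β => x.2.1 := Computable.fst.comp Computable.snd
  refine ⟨fun c p => eq c (add (add (shift p.1) (neg p.1)) p.2),
    heq.comp Computable.fst (hadd.comp (hadd.comp (hshift.comp hfst) (hneg.comp hfst))
      (Computable.snd.comp Computable.snd)), fun c p => ?_⟩
  rw [heq', hadd', hadd', hneg', hshift', ← sub_eq_add_neg]

end IsComputableCoding

namespace SigmaTower

variable {F₀ : Type u} {L : Type v} [Field F₀] [Field L] [Algebra F₀ L] {n : ℕ}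
  (T : SigmaTower F₀ L n)

/-- The element of `F_i` coded by a recursive polynomial. -/
def fieldCoding (i : ℕ) (c : PolyCode F₀ i) : towerField F₀ T.t i :=
  ⟨T.evalCode i c, T.ringSpace_le_fieldSpace i (T.evalCode_mem i c)⟩

lemma aeval_listPoly_fieldCoding {i : ℕ} (l : List (PolyCode F₀ i)) :
    aeval (T.t i) (listPoly (T.fieldCoding i) l) = T.evalCode (i + 1) l := by
  induction l with
  | nil => exact map_zero _
  | cons c l ih =>
    rw [listPoly_cons, map_add, map_mul, aeval_C, aeval_X, ih]
    rfl

lemma exists_evalCode_eq {i : ℕ} {x : L} (hx : x ∈ towerRing F₀ T.t i) :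
    ∃ c : PolyCode F₀ i, T.evalCode i c = x := by
  induction i generalizing x with
  | zero =>
    obtain ⟨a, rfl⟩ := (T.mem_fieldSpace_zero x).1 (T.towerRing_le_towerField 0 hx)
    exact ⟨a, rfl⟩
  | succ i ih =>
    obtain ⟨p, hp, rfl⟩ := T.mem_towerRing_succ.1 hx
    obtain ⟨l, rfl⟩ := exists_listPoly_eq (ev := T.fieldCoding i) fun k =>
      (ih (hp k)).imp fun _ hc => Subtype.ext hc
    exact ⟨l, (T.aeval_listPoly_fieldCoding l).symm⟩

theorem isComputableCoding_fieldCoding [Primcodable F₀] (hT : T.IsRingTower)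
    (hF : IsComputableDifferenceField F₀ T.σ₀) {i : ℕ} (hi : i ≤ n) :
    IsComputableCoding (T.σField i hi) (T.fieldCoding i) := by
  induction i with
  | zero =>
    obtain ⟨isZero, hzero, hzero'⟩ := exists_computable_isZero F₀
    have hid : IsComputableCoding (β := F₀) T.σ₀ id :=
      ⟨⟨0, rfl⟩, ⟨_, hF.add, fun _ _ => rfl⟩, ⟨_, hF.neg, fun _ => rfl⟩,
        fun e => ⟨_, hF.mul.comp (Computable.const e) Computable.id, fun _ => rfl⟩,
        ⟨_, hF.shift, fun _ => rfl⟩, ⟨isZero, hzero, hzero'⟩⟩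
    exact (IsComputableCoding.map_iff (ev := id) (σ := T.σ₀) (σ' := T.σField 0 hi)
      (f := algebraMap F₀ (towerField F₀ T.t 0)) (algebraMap F₀ _).injective
      fun a => Subtype.ext (T.σ_algebraMap a).symm).2 hid
  | succ i ih =>
    have ht := T.isSigmaMonomial i hi
    obtain ⟨a, ha⟩ := T.exists_evalCode_eq (hT i hi)
    have ha' : T.fieldCoding i a = ⟨T.Δ (T.t i), T.diff_mem i hi⟩ := Subtype.ext ha
    have hpoly := (ih (Nat.le_of_succ_le hi)).isComputableCoding_listPoly a
    rw [ha', ← IsComputableCoding.map_iff (f := (aeval (T.t i)).toRingHom) (σ' := T.σ)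
      ht.aeval_injective ht.aeval_shiftPoly] at hpoly
    have heval : T.evalCode (i + 1) = fun l => aeval (T.t i) (listPoly (T.fieldCoding i) l) :=
      funext fun l => (T.aeval_listPoly_fieldCoding l).symm
    refine (IsComputableCoding.map_iff (ev := T.fieldCoding (i + 1)) (σ := T.σField (i + 1) hi)
      (σ' := T.σ) (f := (towerField F₀ T.t (i + 1)).val.toRingHom) Subtype.val_injective
      fun _ => rfl).1 ?_
    change IsComputableCoding T.σ (T.evalCode (i + 1))
    rw [heval]
    exact hpoly

section Coord

variable {ι : Type w} (b : Module.Basis ι T.C F₀)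

lemma canonicalCoord_zero (k : ι) {θ : T.fieldSpace 0} (hθ : (θ : L) = algebraMap F₀ L (b k))
    (a : F₀) : T.canonicalCoord (Set.range b) 0 θ (T.baseEquiv a) = b.repr a k := by
  have hspec := T.canonicalCoord_spec b (Nat.zero_le n) (θ := θ) ⟨b k, ⟨k, rfl⟩, hθ.symm⟩
  suffices T.canonicalCoord (Set.range b) 0 θ ∘ₗ T.baseEquiv.toLinearMap = b.coord k from
    LinearMap.congr_fun this a
  refine b.ext fun m => ?_
  rw [LinearMap.comp_apply, Module.Basis.coord_apply, b.repr_self]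
  rcases eq_or_ne m k with rfl | hmk
  · rw [Finsupp.single_eq_same, ← hspec.1]
    exact congrArg _ (Subtype.ext hθ.symm)
  · rw [Finsupp.single_eq_of_ne hmk.symm]
    exact hspec.2 _ ⟨b m, ⟨m, rfl⟩, rfl⟩ fun h =>
      hmk (b.injective ((algebraMap F₀ L).injective ((congrArg Subtype.val h).trans hθ)))

/-- The `C`-linear map `c ↦ c t_{i+1}^k` from `F_i` to `F_{i+1}`. -/
def mulGenPow (i k : ℕ) : T.fieldSpace i →ₗ[T.C] T.fieldSpace (i + 1) where
  toFun c := ⟨c * T.t i ^ k, mul_mem (S := IntermediateField F₀ L)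
    (T.towerField_mono (Nat.le_succ i) c.2) (pow_mem (T.gen_mem_towerField (Nat.lt_succ_self i)) k)⟩
  map_add' _ _ := Subtype.ext (add_mul _ _ _)
  map_smul' _ _ := Subtype.ext (smul_mul_assoc _ _ _)

lemma aeval_eq_sum_mulGenPow {i : ℕ} (p : (towerField F₀ T.t i)[X]) :
    (⟨aeval (T.t i) p, T.aeval_mem_towerField_succ p⟩ : T.fieldSpace (i + 1)) =
      ∑ k ∈ Finset.range (p.natDegree + 1), T.mulGenPow i k ⟨p.coeff k, (p.coeff k).2⟩ := by
  apply Subtype.ext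
  change aeval (T.t i) p = _
  rw [AddSubmonoidClass.coe_finsetSum, aeval_eq_sum_range]
  exact Finset.sum_congr rfl fun k _ => Algebra.smul_def _ _

variable {i : ℕ} (hi : i < n)
include hi

lemma gen_pow_injective : Function.Injective fun k : ℕ => T.t i ^ k := fun k m hkm => by
  have hX : (X ^ k : (towerField F₀ T.t i)[X]) = X ^ m :=
    (T.isSigmaMonomial i hi).aeval_injective (by simpa using hkm)
  simpa using congrArg natDegree hX

lemma mul_eq_mul_iff_of_mem_canonicalStep {ξ ξ' : towerField F₀ T.t i} (hξ : ξ ≠ 0) {η η' : L}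
    (hη : η ∈ T.canonicalStep i) (hη' : η' ∈ T.canonicalStep i) :
    (ξ : L) * η = ξ' * η' ↔ ξ = ξ' ∧ η = η' := by
  constructor
  · intro h
    have hind := linearIndepOn_partialFractionSet (T.transcendental i hi)
    obtain rfl : η = η' := congrArg Subtype.val
      (LinearIndependent.eq_of_smul_apply_eq_smul_apply hind ξ ξ' ⟨η, hη⟩ ⟨η', hη'⟩ hξ h)
    have hη0 : η ≠ 0 := hind.ne_zero hη
    exact ⟨Subtype.ext (mul_right_cancel₀ hη0 h), rfl⟩
  · rintro ⟨rfl, rfl⟩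
    rfl

variable {ξ : T.fieldSpace i} {η : L} {θ : T.fieldSpace (i + 1)}
  (hξ : (ξ : L) ∈ T.canonicalBasis (Set.range b) i) (hη : η ∈ T.canonicalStep i)
  (hθ : (θ : L) = ξ * η)
include hξ hη hθ

open Classical in
lemma canonicalCoord_comp_mulGenPow (k : ℕ) :
    T.canonicalCoord (Set.range b) (i + 1) θ ∘ₗ T.mulGenPow i k =
      if T.t i ^ k = η then T.canonicalCoord (Set.range b) i ξ else 0 := by
  refine T.eq_of_eqOn_canonicalBasis b hi.le fun ξ' hξ' => ?_
  have hspec := T.canonicalCoord_spec b hi (θ := θ) ⟨ξ, hξ, η, hη, hθ⟩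
  have hspec' := T.canonicalCoord_spec b hi.le (θ := ξ) hξ
  have hk : T.t i ^ k ∈ T.canonicalStep i := Or.inl ⟨k, rfl⟩
  have hmem : (T.mulGenPow i k ξ' : L) ∈ T.canonicalBasis (Set.range b) (i + 1) :=
    ⟨ξ', hξ', _, hk, rfl⟩
  have hξ0 : (ξ' : L) ≠ 0 := (T.linearIndepOn_canonicalBasis b hi.le).ne_zero hξ'
  have hiff : T.mulGenPow i k ξ' = θ ↔ ξ' = ξ ∧ T.t i ^ k = η := by
    rw [Subtype.ext_iff, hθ]
    exact T.mul_eq_mul_iff_of_mem_canonicalStep hi (fun h => hξ0 (congrArg Subtype.val h)) hk hη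
  rw [LinearMap.comp_apply]
  split_ifs with hkη
  · rcases eq_or_ne ξ' ξ with rfl | hne
    · rw [hiff.2 ⟨rfl, hkη⟩, hspec.1, hspec'.1]
    · rw [hspec.2 _ hmem fun h => hne (hiff.1 h).1, hspec'.2 _ hξ' hne]
  · rw [hspec.2 _ hmem fun h => hkη (hiff.1 h).2, LinearMap.zero_apply]

lemma canonicalCoord_aeval_of_eq_gen_pow {k : ℕ} (hk : T.t i ^ k = η)
    (p : (towerField F₀ T.t i)[X]) : T.canonicalCoord (Set.range b) (i + 1) θ
      ⟨aeval (T.t i) p, T.aeval_mem_towerField_succ p⟩ =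
        T.canonicalCoord (Set.range b) i ξ ⟨p.coeff k, (p.coeff k).2⟩ := by
  classical
  have hcomp (m : ℕ) (x : T.fieldSpace i) :=
    LinearMap.congr_fun (T.canonicalCoord_comp_mulGenPow b hi hξ hη hθ m) x
  simp only [LinearMap.comp_apply] at hcomp
  rw [aeval_eq_sum_mulGenPow, map_sum, Finset.sum_eq_single k]
  · rw [hcomp, if_pos hk]
  · intro m _ hmk
    rw [hcomp, if_neg fun h => hmk (T.gen_pow_injective hi (h.trans hk.symm)),
      LinearMap.zero_apply]
  · intro hkp
    rw [coeff_eq_zero_of_natDegree_lt (by simpa using hkp)]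
    exact congrArg _ (map_zero (T.mulGenPow i k)) |>.trans (map_zero _)

lemma canonicalCoord_aeval_of_ne_gen_pow (hne : ∀ k : ℕ, T.t i ^ k ≠ η)
    (p : (towerField F₀ T.t i)[X]) : T.canonicalCoord (Set.range b) (i + 1) θ
      ⟨aeval (T.t i) p, T.aeval_mem_towerField_succ p⟩ = 0 := by
  classical
  rw [aeval_eq_sum_mulGenPow, map_sum]
  refine Finset.sum_eq_zero fun k _ => ?_
  rw [← LinearMap.comp_apply, T.canonicalCoord_comp_mulGenPow b hi hξ hη hθ, if_neg (hne k),
    LinearMap.zero_apply]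

end Coord

theorem exists_computable_canonicalCoord [Primcodable F₀] {ι : Type w}
    {b : Module.Basis ι T.C F₀} (hb : IsEffectiveBasis b) {i : ℕ} (hi : i ≤ n)
    {θ : T.fieldSpace i} (hθ : (θ : L) ∈ T.canonicalBasis (Set.range b) i) :
    ∃ f : PolyCode F₀ i → F₀, Computable f ∧
      ∀ c, f c = (T.canonicalCoord (Set.range b) i θ (T.fieldCoding i c) : F₀) := by
  induction i with
  | zero =>
    obtain ⟨_, ⟨k, rfl⟩, hk⟩ := hθ
    obtain ⟨-, coeff, hcoeff, hcoeff'⟩ := hb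
    have hcomp : Computable fun a : F₀ => coeff (b k) a :=
      hcoeff.comp (Computable.const _) Computable.id
    exact ⟨_, hcomp, fun a =>
      (hcoeff' k a).trans (congrArg _ (T.canonicalCoord_zero b k hk.symm a).symm)⟩
  | succ i ih =>
    obtain ⟨ξ, hξ, η, hη, hθη⟩ := hθ
    obtain ⟨ξ, rfl⟩ : ∃ x : T.fieldSpace i, (x : L) = ξ :=
      ⟨⟨ξ, T.canonicalBasis_subset _ i hξ⟩, rfl⟩
    have heval (l : List (PolyCode F₀ i)) : T.fieldCoding (i + 1) l =
        ⟨aeval (T.t i) (listPoly (T.fieldCoding i) l), T.aeval_mem_towerField_succ _⟩ :=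
      Subtype.ext (T.aeval_listPoly_fieldCoding l).symm
    by_cases hpow : ∃ k, T.t i ^ k = η
    · obtain ⟨k, hk⟩ := hpow
      obtain ⟨f, hf, hf'⟩ := ih (Nat.le_of_succ_le hi) hξ
      obtain ⟨z, hz⟩ := T.exists_evalCode_eq (zero_mem (towerRing F₀ T.t i))
      have hcomp : Computable fun l : List (PolyCode F₀ i) => f (l.getD k z) :=
        hf.comp ((computable_list_getD z).comp Computable.id (Computable.const k))
      refine ⟨_, hcomp, fun l : List (PolyCode F₀ i) => ?_⟩
      have hcoeff : T.fieldCoding i (l.getD k z) = (listPoly (T.fieldCoding i) l).coeff k :=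
        (coeff_listPoly_eq_getD (ev := T.fieldCoding i) (Subtype.ext hz) l k).symm
      rw [hf', heval]
      exact congrArg Subtype.val ((congrArg (T.canonicalCoord (Set.range b) i ξ) hcoeff).trans
        (T.canonicalCoord_aeval_of_eq_gen_pow b hi hξ hη hθη hk _).symm)
    · refine ⟨fun _ => 0, Computable.const 0, fun l : List (PolyCode F₀ i) => ?_⟩
      rw [heval]
      exact congrArg Subtype.val (T.canonicalCoord_aeval_of_ne_gen_pow b hi hξ hη hθη
        (fun k hk => hpow ⟨k, hk⟩) _).symm

lemma mem_remainderGroup_iff {i : ℕ} {l : T.fieldSpace i →ₗ[T.C] T.C}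
    {φ : T.fieldSpace i →ₗ[T.C] T.fieldSpace i} {U : Submodule T.C (T.fieldSpace i)}
    (hφ : IsCompleteReduction U φ) {x : T.fieldSpace i} :
    (⟨x, x.2⟩ : towerField F₀ T.t i) ∈ T.remainderGroup l φ ↔ φ x = x ∧ l x = 0 := by
  constructor
  · rintro ⟨_, ⟨⟨y, rfl⟩, hl⟩, hyx⟩
    obtain rfl : φ y = x := Subtype.ext hyx
    exact ⟨hφ.apply_apply y, hl⟩
  · rintro ⟨hx, hl⟩
    exact ⟨x, ⟨⟨x, hx⟩, hl⟩, rfl⟩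

lemma exists_evalCode_eq_Δ_add [CharZero F₀] (hT : T.IsRingTower) {i : ℕ} (hi : i < n)
    {φ : T.fieldSpace i →ₗ[T.C] T.fieldSpace i} {l : T.fieldSpace i →ₗ[T.C] T.C}
    (hsplit : T.SplitsWithin (towerRing F₀ T.t i) φ) (hne : l (φ (T.diffGen i hi)) ≠ 0)
    (c : List (PolyCode F₀ i)) :
    ∃ g r : List (PolyCode F₀ i),
      T.evalCode (i + 1) c = T.Δ (T.evalCode (i + 1) g) + T.evalCode (i + 1) r ∧
        listPoly (T.fieldCoding i) r ∈ coeffsIn (T.remainderGroup l φ) := by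
  have hc : listPoly (T.fieldCoding i) c ∈
      coeffsIn (T.interField (towerRing F₀ T.t i) i).toAddSubgroup :=
    listPoly_mem_coeffsIn_iff.2 fun d _ => T.evalCode_mem i d
  obtain ⟨g, hg, r, hr, hgr⟩ := T.exists_aeval_eq_Δ_add hi hne
    (fun x hx => T.σ_mem_towerRing hT hi.le hx) (hT i hi) hsplit hc
  have hcode {p : (towerField F₀ T.t i)[X]} (hp : ∀ k, (p.coeff k : L) ∈ towerRing F₀ T.t i) :
      ∃ d, listPoly (T.fieldCoding i) d = p :=
    exists_listPoly_eq fun k => (T.exists_evalCode_eq (hp k)).imp fun _ hd => Subtype.ext hd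
  obtain ⟨g, rfl⟩ := hcode hg
  obtain ⟨r, rfl⟩ := hcode fun k => (hr k).1
  simp only [aeval_listPoly_fieldCoding] at hgr
  exact ⟨g, r, hgr, fun k => (hr k).2⟩

variable [Primcodable F₀]

/-- The map `A` is an algorithm that computes, from a code of `f ∈ E_i`, codes of some `g ∈ E_i` and
of `φ f` with `f = Δ g + φ f`. -/
structure IsReductionAlgorithm (i : ℕ) (φ : T.fieldSpace i →ₗ[T.C] T.fieldSpace i)
    (A : PolyCode F₀ i → PolyCode F₀ i × PolyCode F₀ i) : Prop where
  computable : Computable A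
  evalCode_snd : ∀ c, T.evalCode i (A c).2 = φ (T.fieldCoding i c)
  evalCode_eq : ∀ c, T.evalCode i c = T.Δ (T.evalCode i (A c).1) + T.evalCode i (A c).2

variable {T}

lemma exists_isReductionAlgorithm_zero {φ₀ : F₀ →ₗ[T.C] F₀}
    (hφ₀ : IsPhiComputable (id : F₀ → F₀) (groundDiff T.σ₀) φ₀) :
    ∃ A, T.IsReductionAlgorithm 0 (T.baseEquiv.conj φ₀) A := by
  obtain ⟨-, A, hA, hA'⟩ := hφ₀
  refine ⟨A, hA, fun a : F₀ => ?_, fun a : F₀ => ?_⟩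
  · have ha : T.fieldCoding 0 a = T.baseEquiv a := rfl
    rw [ha, LinearEquiv.conj_apply_apply, LinearEquiv.symm_apply_apply]
    exact congrArg (algebraMap F₀ L) (hA' a).1
  · calc algebraMap F₀ L a = algebraMap F₀ L (T.σ₀ (A a).1 - (A a).1 + (A a).2) :=
          congrArg (algebraMap F₀ L) (hA' a).2
      _ = T.σ (algebraMap F₀ L (A a).1) - algebraMap F₀ L (A a).1 + algebraMap F₀ L (A a).2 := by
          rw [map_add, map_sub, T.σ_algebraMap]

section Step

variable {i : ℕ} {φ : T.fieldSpace i →ₗ[T.C] T.fieldSpace i}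
  {A : PolyCode F₀ i → PolyCode F₀ i × PolyCode F₀ i} (hA : T.IsReductionAlgorithm i φ A)
  {l : T.fieldSpace i →ₗ[T.C] T.C} {coord : PolyCode F₀ i → F₀} (hcoord : Computable coord)
  (hl : ∀ c, coord c = (l (T.fieldCoding i c) : F₀))
  (hT : T.IsRingTower) (hF : IsComputableDifferenceField F₀ T.σ₀)
include hA hcoord hl hT hF

lemma IsReductionAlgorithm.exists_computable_mem_remainderGroup {U : Submodule T.C (T.fieldSpace i)}
    (hφ : IsCompleteReduction U φ) (hi : i ≤ n) :
    ∃ P : PolyCode F₀ i → Bool, Computable P ∧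
      ∀ c, P c = true ↔ T.fieldCoding i c ∈ T.remainderGroup l φ := by
  obtain ⟨eq, heq, heq'⟩ := (T.isComputableCoding_fieldCoding hT hF hi).exists_computable_eq
  obtain ⟨isZero, hzero, hzero'⟩ := exists_computable_isZero F₀
  refine ⟨fun c => eq (A c).2 c && isZero (coord c), computable_and
    (heq.comp (Computable.snd.comp hA.computable) Computable.id) (hzero.comp hcoord), fun c => ?_⟩
  rw [Bool.and_eq_true, heq', hzero', hl, ZeroMemClass.coe_eq_zero]
  refine Iff.trans (and_congr_left' ?_)
    (T.mem_remainderGroup_iff (x := T.fieldCoding i c) (l := l) hφ).symm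
  rw [Subtype.ext_iff]
  exact ((hA.evalCode_snd c).congr_left).trans Subtype.ext_iff.symm

variable [CharZero F₀] (hi : i < n) {S : Set L}
  (hφ : IsCompleteReduction (summableSpace T.Δ (T.fieldSpace i)) φ)
  (hsplit : T.SplitsWithin (towerRing F₀ T.t i) φ) (hne : l (φ (T.diffGen i hi)) ≠ 0)
  (hcompl : IsCompl (T.complement i S l φ) (summableSpace T.Δ (T.fieldSpace (i + 1))))
include hφ hsplit hne hcompl

theorem IsReductionAlgorithm.exists_succ :
    ∃ B, T.IsReductionAlgorithm (i + 1) (T.reductionStep i S l φ) B := by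
  obtain ⟨mem, hmem, hmem'⟩ :=
    hA.exists_computable_mem_remainderGroup hcoord hl hT hF hφ hi.le
  obtain ⟨eqn, heqn, heqn'⟩ :=
    (T.isComputableCoding_fieldCoding hT hF hi).exists_computable_eq_shift_sub_add
  let test (c : List (PolyCode F₀ i)) (p : List (PolyCode F₀ i) × List (PolyCode F₀ i)) : Bool :=
    eqn c p && p.2.all mem
  have htest : Computable₂ test := computable_and heqn
    ((computable_list_all hmem).comp (Computable.snd.comp Computable.snd))
  have htest' (c p) : test c p = true ↔
      T.evalCode (i + 1) c = T.Δ (T.evalCode (i + 1) p.1) + T.evalCode (i + 1) p.2 ∧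
        listPoly (T.fieldCoding i) p.2 ∈ coeffsIn (T.remainderGroup l φ) := by
    simp only [test, Bool.and_eq_true, List.all_eq_true, hmem', listPoly_mem_coeffsIn_iff]
    exact and_congr_left' ((heqn' c p).trans Subtype.ext_iff)
  obtain ⟨B, hB, hB'⟩ := exists_computable_of_forall_exists htest fun c => by
    obtain ⟨g, r, hgr, hr⟩ := T.exists_evalCode_eq_Δ_add hT hi hsplit hne c
    exact ⟨(g, r), (htest' c (g, r)).2 ⟨hgr, hr⟩⟩
  refine ⟨B, hB, fun c => ?_, fun c => ((htest' c (B c)).1 (hB' c)).1⟩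
  obtain ⟨heq, hr⟩ := (htest' c (B c)).1 (hB' c)
  rw [← aeval_listPoly_fieldCoding T (B c).2] at heq ⊢
  exact (T.coe_reductionStep_eq_aeval hcompl (f := T.fieldCoding (i + 1) c)
    (T.fieldCoding (i + 1) (B c).1).2 hr heq).symm

end Step

theorem exists_isReductionAlgorithm [CharZero F₀] {ι : Type w} {b : Module.Basis ι T.C F₀}
    {φ₀ : F₀ →ₗ[T.C] F₀} {S : ℕ → Set L} {θ : (i : ℕ) → T.fieldSpace i}
    (hφ₀ : IsCompleteReduction (LinearMap.range (groundDiff T.σ₀)) φ₀)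
    (hS : ∀ i < n, T.IsRepresentatives i (S i)) (hθ : T.IsSecondPairs (Set.range b) φ₀ S θ)
    (hT : T.IsRingTower) (hF : IsComputableDifferenceField F₀ T.σ₀) (hb : IsEffectiveBasis b)
    (hA : IsPhiComputable (id : F₀ → F₀) (groundDiff T.σ₀) φ₀) {i : ℕ} (hi : i ≤ n) :
    ∃ A, T.IsReductionAlgorithm i (T.reduction (Set.range b) φ₀ S θ i) A := by
  induction i with
  | zero => exact exists_isReductionAlgorithm_zero hA
  | succ i ih =>
    obtain ⟨A, hA⟩ := ih (Nat.le_of_succ_le hi)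
    obtain ⟨coord, hcoord, hl⟩ :=
      T.exists_computable_canonicalCoord hb (Nat.le_of_succ_le hi) (hθ i hi).1
    exact hA.exists_succ hcoord hl hT hF hi
      (T.isCompleteReduction_reduction hφ₀ hS (Nat.le_of_succ_le hi) fun j hj _ => hθ j hj)
      (T.splitsWithin_reduction hφ₀ hS hθ hT (Nat.le_of_succ_le hi)) (hθ i hi).2.1
      (T.isCompl_complement_reduction hφ₀ hS hθ hi)

end SigmaTower

end

theorem mainTheorem12 {F₀ : Type u} {L : Type v} [Field F₀] [CharZero F₀] [Field L] [Algebra F₀ L]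
    {n : ℕ} (T : SigmaTower F₀ L n) (hT : T.IsRingTower)
    {ι : Type w} (b : Module.Basis ι T.C F₀)
    (φ₀ : F₀ →ₗ[T.C] F₀) (hφ₀ : IsCompleteReduction (LinearMap.range (groundDiff T.σ₀)) φ₀)
    (S : ℕ → Set L) (hS : ∀ i < n, T.IsRepresentatives i (S i)) :
    (∃ θ : (i : ℕ) → T.fieldSpace i, T.IsSecondPairs (Set.range b) φ₀ S θ) ∧
    ∀ θ : (i : ℕ) → T.fieldSpace i, T.IsSecondPairs (Set.range b) φ₀ S θ →
      (∀ i < n, IsCompl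
        (T.complement i (S i) (T.canonicalCoord (Set.range b) i (θ i))
          (T.reduction (Set.range b) φ₀ S θ i))
        (summableSpace T.Δ (T.fieldSpace (i + 1)))) ∧
      ∀ i ≤ n,
        (T.fieldSpace i).map T.Δ ≤ T.fieldSpace i ∧
        IsCompleteReduction (summableSpace T.Δ (T.fieldSpace i))
          (T.reduction (Set.range b) φ₀ S θ i) ∧
        ∃ (hΔ : ∀ f ∈ T.ringSpace i, T.Δ f ∈ T.ringSpace i)
          (ψ : T.ringSpace i →ₗ[T.C] T.ringSpace i),
          (∀ f : T.ringSpace i, (ψ f : L) =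
            T.reduction (Set.range b) φ₀ S θ i
              (Submodule.inclusion (T.ringSpace_le_fieldSpace i) f)) ∧
          IsCompleteReduction (LinearMap.range (T.Δ.restrict hΔ)) ψ ∧
          ∀ [Primcodable F₀], IsComputableDifferenceField F₀ T.σ₀ → IsEffectiveBasis b →
            IsPhiComputable (id : F₀ → F₀) (groundDiff T.σ₀) φ₀ →
            IsPhiComputable (T.ringCoding i) (T.Δ.restrict hΔ) ψ := by
  refine ⟨T.exists_isSecondPairs hφ₀ hS, fun θ hθ => ⟨fun i hi =>
    T.isCompl_complement_reduction hφ₀ hS hθ hi, fun i hi => ⟨?_, ?_, ?_⟩⟩⟩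
  · rintro _ ⟨x, hx, rfl⟩
    exact T.Δ_mem_fieldSpace hi hx
  · exact T.isCompleteReduction_reduction hφ₀ hS hi fun j hj _ => hθ j hj
  · obtain ⟨ψ, hψ, hcr⟩ := T.exists_isCompleteReduction_ringSpace hφ₀ hS hθ hT hi
    refine ⟨fun _ hf => T.Δ_mem_ringSpace hT hi hf, ψ, hψ, hcr, fun hF hb hA => ⟨?_, ?_⟩⟩
    · rintro ⟨x, hx⟩
      obtain ⟨c, hc⟩ := T.exists_evalCode_eq hx
      exact ⟨c, Subtype.ext hc⟩
    · obtain ⟨A, hA⟩ := T.exists_isReductionAlgorithm hφ₀ hS hθ hT hF hb hA hi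
      exact ⟨A, hA.computable, fun c =>
        ⟨Subtype.ext ((hA.evalCode_snd c).trans (hψ (T.ringCoding i c)).symm),
          Subtype.ext (hA.evalCode_eq c)⟩⟩
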